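/- **Setting.** Let $0<\rho<1/2$, $0<\varepsilon<1/4$ and $\delta>0$. Let $G$ be a finite group and let $A=A^{-1}$, $B=B^{-1}$ be subsets of $G$ with $|A|=|B|=\Delta$, such that the left Cayley graph $\mathrm{Cay}(G,A)$ and the right Cayley graph $\mathrm{Cay}(G,B)$ are connected non-bipartite Ramanujan graphs (every adjacency eigenvalue other than $\pm\Delta$ has absolute value at most $2\sqrt{\Delta-1}$). For $i,j\in\{0,1\}$ let $V_{ij}=G\times\{ij\}$, let $V_0=V_{00}\cup V_{11}$, and let $Q$ be the set of squares $\{(g,00),(ag,01),(gb,10),(agb,11)\}$, $g\in G,\ a\in A,\ b\in B$. For a vertex $v$ let $Q(v)$ be the set of squares that contain $v$; it is labelled by $A\times B$ through the elements $a,b$ that define the square. So two vertices joined by an edge $\{(g,0j),(gb,1j)\}$ share a column of their arrays, and two vertices joined by an edge $\{(g,i0),(ag,i1)\}$ share a row. Let $C_A\subset\mathbb F_2^A$, $C_B\subset\mathbb F_2^B$ be linear codes such that 1. $0<\dim C_A\le\rho\Delta$ and $\dim C_B=\Delta-\dim C_A$; 2. the minimum distances of $C_A,C_B,C_A^\perp,C_B^\perp$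 are all at least $\delta\Delta$; 3. the dual tensor codes $(C_A\otimes C_B)^\perp=C_A^\perp\otimes\mathbb F_2^B+\mathbb F_2^A\otimes C_B^\perp$ and $(C_A^\perp\otimes C_B^\perp)^\perp=C_A\otimes\mathbb F_2^B+\mathbb F_2^A\otimes C_B$ are both $\Delta^{3/2-\varepsilon}$-robust with $\Delta^{1-\varepsilon}$-resistance to puncturing. Here $C\otimes\mathbb F_2^J$ (respectively $\mathbb F_2^I\otimes C$) is the space of $I\times J$ matrices whose columns (respectively rows) belong to $C$. The code $C_I\otimes\mathbb F_2^J+\mathbb F_2^I\otimes C_J$ is *$w$-robust* if every codeword $x$ of Hamming weight $|x|\le w$ is supported on the union of at most $|x|/d(C_J)$ rows and at most $|x|/d(C_I)$ columns, where $d$ is the minimum distance. It is $w$-robust *with $p$-resistance to puncturing* if for every $w'\le p$ and all $I'\subset I$, $J'\subset J$ with $|I'|=|I|-w'$, $|J'|=|J|-w'$, the dual tensor code of the restrictions of $C_I$ to $I'$ and of $C_J$ to $J'$ is $w$-robust. A *decomposition* of a vector $\hat Z\in\mathbb F_2^Q$ is a quadruple $\mathcal Z=(C_0,R_0,C_1,R_1)$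 of vectors of $\mathbb F_2^Q$ with $\hat Z=C_0+R_0+C_1+R_1$ such that, writing $c_v,r_v$ for local views on $Q(v)$: for $v\in V_{10}$ the views of $C_0$ and $R_1$ satisfy $c_v\in C_A\otimes\mathbb F_2^B$ and $r_v\in\mathbb F_2^A\otimes C_B$; and for $v\in V_{01}$ the views of $C_1$ and $R_0$ satisfy $c_v\in C_A\otimes\mathbb F_2^B$ and $r_v\in\mathbb F_2^A\otimes C_B$. Its norm is $\sum_{v\in V_{10}\cup V_{01}}(\|c_v\|+\|r_v\|)$, where $\|c_v\|$ is the number of nonzero columns of $c_v$ and $\|r_v\|$ the number of nonzero rows of $r_v$. A *minimal* decomposition of $\hat Z$ is one of least norm. The set $S_0$ of *active vertices* of $\mathcal Z$ in $V_0$ consists of the $v\in V_{ii}$, $i=0,1$, such that $R_i+C_i$ is nonzero on $Q(v)$. The *sequential decoder* replaces the current mismatch $\hat Z$ by $\hat Z+c_v+r_v$ whenever there are $v\in V_0$, $c_v\in C_A\otimes\mathbb F_2^B$ and $r_v\in\mathbb F_2^A\otimes C_B$ (placed on $Q(v)$ and extended by $0$) with $|\hat Z+c_v+r_v|<|\hat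 Z|$. It is *stalled* at $\hat Z$ when there is no such triple. **Proposition.** There is a constant $\kappa>0$ such that for all $\rho,\varepsilon,\delta$ as above and all $\Delta\ge\Delta_0(\rho,\varepsilon,\delta)$ the following holds for all $G,A,B,C_A,C_B$ as above. Let $\hat Z\in\mathbb F_2^Q$ be a vector that has a decomposition and at which the sequential decoder is stalled, and let $S_0$ be the set of active vertices in $V_0$ of a minimal decomposition of $\hat Z$. If $|S_0|\le\frac{\delta}{8\Delta}|V_0|$, then $$|\hat Z|\ \ge\ \kappa\,|S_0|\,\Delta^{1/2-\varepsilon}.$$ -/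

import Mathlib

universe u

namespace QTanner

section Codes

variable {I J : Type*} [Fintype I] [Fintype J]

/-- The minimum distance of a binary linear code: the least Hamming weight of a nonzero codeword
(with value `0` for the zero code). -/
noncomputable def minDist (C : Submodule (ZMod 2) (I → ZMod 2)) : ℕ :=
  sInf {n : ℕ | ∃ x ∈ C, x ≠ 0 ∧ hammingNorm x = n}

/-- The dual code `C^⊥`. -/
def dualCode (C : Submodule (ZMod 2) (I → ZMod 2)) : Submodule (ZMod 2) (I → ZMod 2) where
  carrier := {x | ∀ y ∈ C, ∑ i, x i * y i = 0}
  zero_mem' := by intro y _; simp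
  add_mem' := by
    intro x x' hx hx' y hy
    simp [add_mul, Finset.sum_add_distrib, hx y hy, hx' y hy]
  smul_mem' := by
    intro t x hx y hy
    simp [mul_assoc, ← Finset.mul_sum, hx y hy]

/-- The punctured code `C_{I'}`: the restrictions to the coordinate set `I'` of the words of `C`. -/
def puncture (C : Submodule (ZMod 2) (I → ZMod 2)) (I' : Finset I) :
    Submodule (ZMod 2) (I' → ZMod 2) :=
  C.map (LinearMap.funLeft (ZMod 2) (ZMod 2) (fun i : I' => (i : I)))

/-- `C_I ⊗ F_2^J`: the matrices all of whose columns are words of `C_I`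
(rows are indexed by `I`, columns by `J`). -/
def colCode (CI : Submodule (ZMod 2) (I → ZMod 2)) (J : Type*) :
    Submodule (ZMod 2) (I × J → ZMod 2) where
  carrier := {x | ∀ j, (fun i => x (i, j)) ∈ CI}
  zero_mem' := fun _ => CI.zero_mem
  add_mem' := fun hx hy j => CI.add_mem (hx j) (hy j)
  smul_mem' := fun t _ hx j => CI.smul_mem t (hx j)

/-- `F_2^I ⊗ C_J`: the matrices all of whose rows are words of `C_J`. -/
def rowCode (I : Type*) (CJ : Submodule (ZMod 2) (J → ZMod 2)) :
    Submodule (ZMod 2) (I × J → ZMod 2) where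
  carrier := {x | ∀ i, (fun j => x (i, j)) ∈ CJ}
  zero_mem' := fun _ => CJ.zero_mem
  add_mem' := fun hx hy i => CJ.add_mem (hx i) (hy i)
  smul_mem' := fun t _ hx i => CJ.smul_mem t (hx i)

/-- The dual tensor code `C_I ⊗ F_2^J + F_2^I ⊗ C_J`. -/
def dualTensorCode (CI : Submodule (ZMod 2) (I → ZMod 2)) (CJ : Submodule (ZMod 2) (J → ZMod 2)) :
    Submodule (ZMod 2) (I × J → ZMod 2) :=
  colCode CI J ⊔ rowCode I CJ

/-- The dual tensor code of `C_I`, `C_J` is `w`-robust: every codeword `x` of weight at most `w`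
is supported on at most `|x| / d(C_J)` rows and at most `|x| / d(C_I)` columns. -/
def IsRobust (CI : Submodule (ZMod 2) (I → ZMod 2)) (CJ : Submodule (ZMod 2) (J → ZMod 2))
    (w : ℝ) : Prop :=
  ∀ x ∈ dualTensorCode CI CJ, (hammingNorm x : ℝ) ≤ w →
    ∃ (I' : Finset I) (J' : Finset J),
      (I'.card : ℝ) ≤ (hammingNorm x : ℝ) / (minDist CJ : ℝ) ∧
      (J'.card : ℝ) ≤ (hammingNorm x : ℝ) / (minDist CI : ℝ) ∧
      ∀ i j, i ∉ I' → j ∉ J' → x (i, j) = 0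

/-- `w`-robustness with `p`-resistance to puncturing, for two codes of the same length: the dual
tensor code stays `w`-robust when the same number `w' ≤ p` of coordinates is removed from both
component codes. -/
def IsRobustResistant (CI : Submodule (ZMod 2) (I → ZMod 2))
    (CJ : Submodule (ZMod 2) (J → ZMod 2)) (w p : ℝ) : Prop :=
  ∀ (I' : Finset I) (J' : Finset J) (w' : ℕ), (w' : ℝ) ≤ p →
    I'.card + w' = Fintype.card I → J'.card + w' = Fintype.card J →
    IsRobust (puncture CI I') (puncture CJ J') w

/-- The conditions on two component codes of length `Δ`, with the resistance parameter
`Δ ^ γ`, `γ = 1 - ε`. The dual tensor code of `C_A^⊥`, `C_B^⊥` is `(C_A ⊗ C_B)^⊥`, and that of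
`C_A`, `C_B` is `(C_A^⊥ ⊗ C_B^⊥)^⊥`. -/
structure GoodComponentCodes (ρ ε δ : ℝ) (Δ : ℕ) (CA : Submodule (ZMod 2) (I → ZMod 2))
    (CB : Submodule (ZMod 2) (J → ZMod 2)) : Prop where
  dim_pos : 0 < Module.finrank (ZMod 2) CA
  dim_le : (Module.finrank (ZMod 2) CA : ℝ) ≤ ρ * Δ
  dim_add : Module.finrank (ZMod 2) CA + Module.finrank (ZMod 2) CB = Δ
  dist_A : δ * Δ ≤ (minDist CA : ℝ)
  dist_B : δ * Δ ≤ (minDist CB : ℝ)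
  dist_dual_A : δ * Δ ≤ (minDist (dualCode CA) : ℝ)
  dist_dual_B : δ * Δ ≤ (minDist (dualCode CB) : ℝ)
  robust_zero : IsRobustResistant (dualCode CA) (dualCode CB)
    ((Δ : ℝ) ^ (3 / 2 - ε)) ((Δ : ℝ) ^ (1 - ε))
  robust_one : IsRobustResistant CA CB ((Δ : ℝ) ^ (3 / 2 - ε)) ((Δ : ℝ) ^ (1 - ε))

open Classical in
/-- The norm `‖c‖` of an element of `C_A ⊗ F_2^B`: its number of nonzero columns. -/
noncomputable def colNorm (c : I × J → ZMod 2) : ℕ :=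
  (Finset.univ.filter fun j : J => ∃ i, c (i, j) ≠ 0).card

open Classical in
/-- The norm `‖r‖` of an element of `F_2^A ⊗ C_B`: its number of nonzero rows. -/
noncomputable def rowNorm (r : I × J → ZMod 2) : ℕ :=
  (Finset.univ.filter fun i : I => ∃ j, r (i, j) ≠ 0).card

end Codes

section Graphs

open Classical in
/-- A graph on a finite vertex set (loops allowed), of degree `Δ`, is a connected non-bipartite
Ramanujan graph: every eigenvalue of its adjacency matrix other than `±Δ` has absolute value at
most `2 √(Δ - 1)`. -/
def IsNonbipartiteRamanujan {V : Type*} [Fintype V] (adj : V → V → Prop) (Δ : ℕ) : Prop :=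
  (∀ g h, Relation.ReflTransGen adj g h) ∧
  (¬ ∃ f : V → Bool, ∀ g h, adj g h → f g ≠ f h) ∧
  ∀ μ : ℝ, Module.End.HasEigenvalue
      (Matrix.toLin' (Matrix.of fun g h : V => if adj g h then (1 : ℝ) else 0)) μ →
    |μ| ≠ (Δ : ℝ) → |μ| ≤ 2 * Real.sqrt ((Δ : ℝ) - 1)

/-- Adjacency in the Cayley graph `Cay(G, A)` defined by left multiplication. -/
def leftCayleyAdj {G : Type*} [Group G] (A : Finset G) (g h : G) : Prop := ∃ a ∈ A, h = a * g

/-- Adjacency in the Cayley graph `Cay(G, B)` defined by right multiplication. -/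
def rightCayleyAdj {G : Type*} [Group G] (B : Finset G) (g h : G) : Prop := ∃ b ∈ B, h = g * b

/-- The generating sets of the left-right Cayley complex. -/
structure GoodGenerators {G : Type*} [Group G] [Fintype G] (A B : Finset G) (Δ : ℕ) : Prop where
  card_A : A.card = Δ
  card_B : B.card = Δ
  symm_A : ∀ a ∈ A, a⁻¹ ∈ A
  symm_B : ∀ b ∈ B, b⁻¹ ∈ B
  ramanujan_A : IsNonbipartiteRamanujan (leftCayleyAdj A) Δ
  ramanujan_B : IsNonbipartiteRamanujan (rightCayleyAdj B) Δ

end Graphs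

section Complex

/-- The vertices of the quadripartite complex: `(g, i, j)` is the vertex `(g, ij)` of `V_{ij}`. -/
abbrev Vertex (G : Type*) := G × Fin 2 × Fin 2

variable {G : Type*} [Group G]

/-- The set `Q` of squares: `(g, a, b)` stands for the square with vertex set
`{(g,00), (ag,01), (gb,10), (agb,11)}`, which determines `g`, `a` and `b`
(see `corners_injective`). -/
abbrev Square (A B : Finset G) := G × A × B

variable {A B : Finset G}

/-- The four vertices of a square. -/
def corners (q : Square A B) : Set (Vertex G) :=
  {(q.1, 0, 0), (q.2.1 * q.1, 0, 1), (q.1 * q.2.2, 1, 0), (q.2.1 * q.1 * q.2.2, 1, 1)}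

/-- The labelling `φ_v` of the `Q`-neighbourhood `Q(v)` by `A × B`. -/
def label (v : Vertex G) (ab : A × B) : Square A B :=
  match v with
  | (g, 0, 0) => (g, ab)
  | (g, 0, 1) => ((ab.1 : G)⁻¹ * g, ab)
  | (g, 1, 0) => (g * (ab.2 : G)⁻¹, ab)
  | (g, 1, 1) => ((ab.1 : G)⁻¹ * g * (ab.2 : G)⁻¹, ab)

theorem corners_injective : Function.Injective (corners : Square A B → Set (Vertex G)) := by
  rintro ⟨g, a, b⟩ ⟨g', a', b'⟩ h
  have h1 : ((g, 0, 0) : Vertex G) ∈ corners (g', a', b') := by rw [← h]; simp [corners]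
  have h2 : ((a * g, 0, 1) : Vertex G) ∈ corners (g', a', b') := by rw [← h]; simp [corners]
  have h3 : ((g * b, 1, 0) : Vertex G) ∈ corners (g', a', b') := by rw [← h]; simp [corners]
  simp [corners] at h1 h2 h3
  subst h1
  simp at h2 h3
  simp [h2, h3]

/-- `label v` is a one-to-one map onto the squares incident to `v`. -/
theorem label_injective (v : Vertex G) : Function.Injective (label v : A × B → Square A B) := by
  obtain ⟨g, i, j⟩ := v
  intro x y h
  fin_cases i <;> fin_cases j <;> exact congrArg Prod.snd h

theorem exists_label_iff (v : Vertex G) (q : Square A B) :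
    (∃ ab, label v ab = q) ↔ v ∈ corners q := by
  obtain ⟨g, i, j⟩ := v
  obtain ⟨g', a, b⟩ := q
  fin_cases i <;> fin_cases j <;>
    simp [label, corners, inv_mul_eq_iff_eq_mul, mul_inv_eq_iff_eq_mul, mul_assoc]

/-- The local view on `Q(v)` of a vector of `F_2^Q`, as an array indexed by `A × B`. -/
def view (v : Vertex G) (x : Square A B → ZMod 2) : A × B → ZMod 2 := fun ab => x (label v ab)

/-- The vector of `F_2^Q` equal to the array `y` on `Q(v)` and to `0` outside `Q(v)`. -/
noncomputable def pad (v : Vertex G) (y : A × B → ZMod 2) : Square A B → ZMod 2 :=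
  Function.extend (label v) y 0

/-- `V_0 = V_{00} ∪ V_{11}`. -/
def V0 (G : Type*) [Fintype G] : Finset (Vertex G) :=
  Finset.univ.filter fun v => v.2.1 = v.2.2

variable (CA : Submodule (ZMod 2) (A → ZMod 2)) (CB : Submodule (ZMod 2) (B → ZMod 2))

/-- The data `(C_0, R_0, C_1, R_1)` of a decomposition: `C_0` and `R_1` are assembled from local
views in `C_A ⊗ F_2^B` and `F_2^A ⊗ C_B` at the vertices of `V_{10}`, and `C_1` and `R_0` from
local views at the vertices of `V_{01}`. -/
structure Decomposition where
  C : Fin 2 → Square A B → ZMod 2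
  R : Fin 2 → Square A B → ZMod 2
  C0_mem : ∀ g : G, view (g, 1, 0) (C 0) ∈ colCode CA B
  R1_mem : ∀ g : G, view (g, 1, 0) (R 1) ∈ rowCode A CB
  C1_mem : ∀ g : G, view (g, 0, 1) (C 1) ∈ colCode CA B
  R0_mem : ∀ g : G, view (g, 0, 1) (R 0) ∈ rowCode A CB

variable {CA CB}

/-- The vector `C_0 + R_0 + C_1 + R_1` that is decomposed. -/
def Decomposition.total (D : Decomposition CA CB) : Square A B → ZMod 2 :=
  D.C 0 + D.R 0 + D.C 1 + D.R 1

/-- The norm `‖C_0‖ + ‖R_0‖ + ‖C_1‖ + ‖R_1‖` of a decomposition. -/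
noncomputable def Decomposition.norm [Fintype G] (D : Decomposition CA CB) : ℕ :=
  (∑ g : G, colNorm (view (g, 1, 0) (D.C 0))) + (∑ g : G, rowNorm (view (g, 0, 1) (D.R 0))) +
  (∑ g : G, colNorm (view (g, 0, 1) (D.C 1))) + ∑ g : G, rowNorm (view (g, 1, 0) (D.R 1))

/-- `D` is a minimal decomposition of `Z`. -/
def Decomposition.IsMinimal [Fintype G] (D : Decomposition CA CB) (Z : Square A B → ZMod 2) :
    Prop :=
  D.total = Z ∧ ∀ D' : Decomposition CA CB, D'.total = Z → D.norm ≤ D'.norm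

open Classical in
/-- The active vertices of `V_0`: those `v ∈ V_{ii}` for which `R_i + C_i` is nonzero on `Q(v)`. -/
noncomputable def Decomposition.active [Fintype G] (D : Decomposition CA CB) :
    Finset (Vertex G) :=
  (V0 G).filter fun v => view v (D.R v.2.1 + D.C v.2.2) ≠ 0

variable (CA CB)

/-- One update of the sequential procedure, from the mismatch `Z` to the mismatch `Z'`: the
addition, at a vertex of `V_0`, of a local codeword `c_v + r_v` that lowers the Hamming weight. -/
def SequentialStep [Fintype G] (Z Z' : Square A B → ZMod 2) : Prop :=
  ∃ v ∈ V0 G, ∃ c ∈ colCode CA B, ∃ r ∈ rowCode A CB,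
    Z' = Z + pad v (c + r) ∧ hammingNorm Z' < hammingNorm Z

/-- The sequential decoder is stalled at the mismatch `Z`. -/
def IsStalled [Fintype G] (Z : Square A B → ZMod 2) : Prop :=
  ¬ ∃ Z', SequentialStep CA CB Z Z'

end Complex

end QTanner

/-! Write `s = √Δ`, `e = Δ ^ ε`, `σ = |S_0|`, `d = δ Δ`, and suppose that `|Ẑ| < σ s / (64 e)`. The
word C_j consists of columns shared by V_{0j} and V_{1j}, and R_i of rows shared by V_{i0} and
V_{i1}. So at a vertex of V_{ij} the mismatch is C_j + R_i plus the pair read at the opposite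
corners of the squares.

Stalling forces every local codeword at a vertex of V_0 to have at least half of its support off the
support of Ẑ (`IsStalled.hammingNorm_le`). Where C_k + R_k is nonzero and Ẑ vanishes, the opposite
corner is active. Call a vertex of V_0 exceptional if its view has weight more than a small multiple
of Δ^{3/2-ε}. It has many active opposite corners, so by expander mixing there are only O(σ
Δ^{2ε-1}) of them, the constant depending on δ. At any other vertex of V_0, robustness and
minimality of the decomposition leave at most `s / (8 e)` nonzero columns and rows together
(`Decomposition.IsMinimal.norm_le_of_notMem`).

Apply stalling to one nonzero column or row at a nonexceptional vertex. Its weight is at least `d`,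
and few of its entries are met by the other word, so the V_1 vertex sharing it has at least `d / 4`
active neighbours. By mixing, only O(σ / Δ) vertices of V_1 are that dense. Yet they receive a
nonzero column or row from every nonexceptional active vertex.

Averaging (`Decomposition.exists_lt_regularDegree`) finds a vertex of V_1 that receives more than a
constant times Δ columns and rows, has at most Δ^{1-ε} exceptional neighbours, and sees little of Ẑ.
Puncture the exceptional rows and columns. What remains of its view is a sum of Ẑ and of words
sparse at nonexceptional vertices, hence has weight at most Δ^{3/2-ε}. Punctured robustness and
minimality (`Decomposition.IsMinimal.norm_le_of_few_exceptional`) then bound its columns and rows by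
a smaller multiple of Δ, a contradiction. -/

namespace QTanner

/-! ### Spectral gap of Ramanujan graphs and expander mixing. -/

section Spectral

variable {V : Type*} [Fintype V]

/-- On a connected graph of degree `Δ`, a function with `∑_{h ~ g} f h = s Δ f g`, `s = ±1`,
satisfies `f h = s f g` along every edge. -/
theorem eq_mul_of_adj_of_extremal {adj : V → V → Prop} {Δ : ℕ}
    (hconn : ∀ g h, Relation.ReflTransGen adj g h) (N : V → Finset V)
    (hN : ∀ g h, h ∈ N g ↔ adj g h) (hdeg : ∀ g, (N g).card = Δ) {s : ℝ} (hs : s * s = 1)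
    {f : V → ℝ} (hf : ∀ g, ∑ h ∈ N g, f h = s * Δ * f g) :
    (∀ g h, f g ^ 2 = f h ^ 2) ∧ ∀ g h, adj g h → f h = s * f g := by
  rcases isEmpty_or_nonempty V with hV | hV
  · exact ⟨fun g => isEmptyElim g, fun g => isEmptyElim g⟩
  -- Maximum principle: where f² is maximal, the terms f(g)² - s f(g) f(h) are nonnegative and sum
  -- to zero, so each neighbour is again a maximiser; connectedness spreads this to all of V.
  obtain ⟨g₀, hg₀⟩ := Finite.exists_max fun g => f g ^ 2
  have key : ∀ g, f g ^ 2 = f g₀ ^ 2 → ∀ h, adj g h → f h = s * f g := by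
    intro g hg h hgh
    have hnn : ∀ h ∈ N g, 0 ≤ f g ^ 2 - s * f g * f h := by
      intro h _
      have h1 : f h ^ 2 ≤ f g ^ 2 := hg ▸ hg₀ h
      nlinarith [sq_nonneg (s * f g - f h)]
    have hsum : ∑ h ∈ N g, (f g ^ 2 - s * f g * f h) = 0 := by
      rw [Finset.sum_sub_distrib, ← Finset.mul_sum, hf, Finset.sum_const, hdeg, nsmul_eq_mul]
      linear_combination (-(Δ : ℝ) * f g ^ 2) * hs
    have h0 := (Finset.sum_eq_zero_iff_of_nonneg hnn).1 hsum h ((hN g h).2 hgh)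
    have h1 : f h ^ 2 ≤ f g ^ 2 := hg ▸ hg₀ h
    have h2 : (f h - s * f g) ^ 2 ≤ 0 := by nlinarith
    have h3 : (f h - s * f g) ^ 2 = 0 := le_antisymm h2 (sq_nonneg _)
    linarith [pow_eq_zero_iff (two_ne_zero) |>.1 h3]
  have hall : ∀ g, f g ^ 2 = f g₀ ^ 2 := by
    intro g
    induction hconn g₀ g with
    | refl => rfl
    | tail _ hbc ih =>
      rw [key _ ih _ hbc, mul_pow, ih, pow_two s, hs, one_mul]
  exact ⟨fun g h => by rw [hall g, hall h], fun g h => key g (hall g) h⟩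

/-- On a connected nonbipartite Ramanujan graph, the adjacency operator contracts functions of
mean zero. -/
theorem IsNonbipartiteRamanujan.sum_sq_le {adj : V → V → Prop} {Δ : ℕ}
    (hadj : IsNonbipartiteRamanujan adj Δ) (hΔ : 1 ≤ Δ) (hsymm : ∀ g h, adj g h → adj h g)
    (N : V → Finset V) (hN : ∀ g h, h ∈ N g ↔ adj g h) (hdeg : ∀ g, (N g).card = Δ)
    (f : V → ℝ) (hf : ∑ g, f g = 0) :
    ∑ g, (∑ h ∈ N g, f h) ^ 2 ≤ 4 * Δ * ∑ g, f g ^ 2 := by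
  classical
  obtain ⟨hconn, hbip, heig⟩ := hadj
  set M : Matrix V V ℝ := Matrix.of fun g h : V => if adj g h then (1 : ℝ) else 0 with hM
  have hMv : ∀ (x : V → ℝ) g, M.mulVec x g = ∑ h ∈ N g, x h := by
    intro x g
    simp only [Matrix.mulVec, dotProduct, hM, Matrix.of_apply, ite_mul, one_mul, zero_mul]
    rw [← Finset.sum_filter]
    congr 1
    ext h
    simp [hN]
  have hherm : M.IsHermitian := by
    ext g h
    simp only [hM, Matrix.conjTranspose_apply, Matrix.of_apply, star_trivial]
    exact if_congr ⟨hsymm _ _, hsymm _ _⟩ rfl rfl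
  set b := hherm.eigenvectorBasis with hb
  have hbv : ∀ i, M.mulVec (b i) = hherm.eigenvalues i • (b i : V → ℝ) :=
    fun i => hherm.mulVec_eigenvectorBasis i
  have hsymmM : ∀ x y : V → ℝ, ∑ g, x g * M.mulVec y g = ∑ g, M.mulVec x g * y g := by
    intro x y
    have := Matrix.dotProduct_mulVec x M y
    rw [← Matrix.mulVec_transpose] at this
    have ht : M.transpose = M := by
      have := hherm.eq
      rwa [Matrix.conjTranspose_eq_transpose_of_trivial] at this
    rw [ht] at this
    exact this
  have hin : ∀ i (x : V → ℝ), inner ℝ (b i) (WithLp.toLp 2 x) = ∑ g, (b i) g * x g := by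
    intro i x
    simp [PiLp.inner_apply, mul_comm]
  have hcoef : ∀ i, inner ℝ (b i) (WithLp.toLp 2 (M.mulVec f)) =
      hherm.eigenvalues i * inner ℝ (b i) (WithLp.toLp 2 f) := by
    intro i
    rw [hin, hin, hsymmM, hbv, Finset.mul_sum]
    simp [mul_assoc]
  have hbne : ∀ i, ∃ g, (b i) g ≠ 0 := by
    intro i
    by_contra! h
    have : b i = 0 := by ext g; simpa using h g
    have h1 := b.orthonormal.1 i
    rw [this] at h1
    simp at h1
  have hbound : ∀ i, (inner ℝ (b i) (WithLp.toLp 2 (M.mulVec f)) : ℝ) ^ 2 ≤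
      4 * Δ * (inner ℝ (b i) (WithLp.toLp 2 f) : ℝ) ^ 2 := by
    intro i
    rw [hcoef, mul_pow]
    -- For eigenvalue Δ the eigenvector is constant, hence orthogonal to f. For -Δ its signs would
    -- 2-colour the graph. All other eigenvalues have square at most 4Δ.
    by_cases hi : |hherm.eigenvalues i| = Δ
    · rcases eq_or_eq_neg_of_abs_eq hi with h | h
      · have h1 := eq_mul_of_adj_of_extremal hconn N hN hdeg (s := 1) (by norm_num)
          (f := (b i : V → ℝ)) (by
            intro g
            rw [← hMv, hbv, h]
            simp)
        have hc : ∀ g h, (b i) g = (b i) h := by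
          intro g h
          induction hconn g h with
          | refl => rfl
          | tail _ hbc ih => rw [ih, h1.2 _ _ hbc, one_mul]
        obtain ⟨g₀, -⟩ := hbne i
        have : (inner ℝ (b i) (WithLp.toLp 2 f) : ℝ) = 0 := by
          rw [hin, Finset.sum_congr rfl fun g _ => by rw [hc g g₀], ← Finset.mul_sum, hf, mul_zero]
        simp [this]
      · exfalso
        have h1 := eq_mul_of_adj_of_extremal hconn N hN hdeg (s := -1) (by norm_num)
          (f := (b i : V → ℝ)) (by
            intro g
            rw [← hMv, hbv, h]
            simp)
        obtain ⟨g₀, hg₀⟩ := hbne i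
        refine hbip ⟨fun g => decide (0 < (b i) g), fun g h hgh => ?_⟩
        have hg : (b i) g ≠ 0 := by
          intro h0
          have := h1.1 g₀ g
          rw [h0] at this
          exact hg₀ (pow_eq_zero_iff two_ne_zero |>.1 (by simpa using this))
        beta_reduce
        rw [h1.2 _ _ hgh]
        rcases lt_or_gt_of_ne hg with h' | h' <;> simp [h', h'.le]
    · have hev : Module.End.HasEigenvalue (Matrix.toLin' M) (hherm.eigenvalues i) := by
        refine Module.End.hasEigenvalue_of_hasEigenvector (x := (b i : V → ℝ)) ⟨?_, ?_⟩
        · rw [Module.End.mem_eigenspace_iff, Matrix.toLin'_apply]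
          exact hbv i
        · obtain ⟨g₀, hg₀⟩ := hbne i
          exact fun h => hg₀ (congrFun h g₀)
      have h2 : |hherm.eigenvalues i| ≤ 2 * Real.sqrt ((Δ : ℝ) - 1) := by
        refine heig _ ?_ hi
        convert! hev using 4
      have h3 : hherm.eigenvalues i ^ 2 ≤ 4 * Δ := by
        have h1 : (1 : ℝ) ≤ Δ := by exact_mod_cast hΔ
        calc _ = |hherm.eigenvalues i| ^ 2 := (sq_abs _).symm
          _ ≤ (2 * Real.sqrt ((Δ : ℝ) - 1)) ^ 2 := by gcongr
          _ = 4 * (Δ - 1) := by rw [mul_pow, Real.sq_sqrt (by linarith)]; ring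
          _ ≤ 4 * Δ := by linarith
      gcongr
  have hpars : ∀ x : V → ℝ, ∑ g, x g ^ 2 = ∑ i, (inner ℝ (b i) (WithLp.toLp 2 x) : ℝ) ^ 2 := by
    intro x
    have h1 := b.sum_sq_norm_inner_right (WithLp.toLp 2 x)
    simp only [Real.norm_eq_abs, sq_abs] at h1
    rw [h1, EuclideanSpace.norm_sq_eq]
    simp
  calc ∑ g, (∑ h ∈ N g, f h) ^ 2 = ∑ g, M.mulVec f g ^ 2 := by simp only [hMv]
    _ ≤ ∑ i, 4 * Δ * (inner ℝ (b i) (WithLp.toLp 2 f) : ℝ) ^ 2 := by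
        rw [hpars]; exact Finset.sum_le_sum fun i _ => hbound i
    _ = _ := by rw [← Finset.mul_sum, ← hpars]

open Classical in
/-- The expander mixing lemma, for a linear operator `K` that multiplies constants by `D` and
functions of mean zero by at most `L`. -/
theorem mixing (K : (V → ℝ) →ₗ[ℝ] (V → ℝ)) {D L : ℝ} (hL : 0 ≤ L)
    (hK1 : ∀ g, K (fun _ => 1) g = D)
    (hK : ∀ f : V → ℝ, ∑ g, f g = 0 → ∑ g, K f g ^ 2 ≤ L ^ 2 * ∑ g, f g ^ 2)
    (S T : Finset V) :
    ∑ h ∈ T, K (fun g => if g ∈ S then 1 else 0) h ≤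
      D * S.card * T.card / Fintype.card V + L * Real.sqrt (S.card * T.card) := by
  rcases isEmpty_or_nonempty V with hV | hV
  · have : T = ∅ := Finset.eq_empty_of_isEmpty T
    simp [this]
  have hn : (0 : ℝ) < Fintype.card V := by exact_mod_cast Fintype.card_pos
  set n : ℝ := (Fintype.card V : ℝ)
  set m : ℝ := S.card / n
  set f : V → ℝ := fun g => (if g ∈ S then 1 else 0) - m with hf
  have hsum1 : ∑ g : V, (if g ∈ S then (1 : ℝ) else 0) = S.card := by simp
  have hf0 : ∑ g, f g = 0 := by
    simp only [hf, Finset.sum_sub_distrib, hsum1, Finset.sum_const, nsmul_eq_mul]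
    simp only [Finset.card_univ, m]
    field_simp
    ring
  have hf2 : ∑ g, f g ^ 2 ≤ S.card := by
    -- This uses that the indicator is idempotent; the second term sums to zero.
    have : ∀ g, f g ^ 2 = (1 - m) * (if g ∈ S then 1 else 0) - m * f g := by
      intro g; simp only [hf]; split_ifs <;> ring
    rw [Finset.sum_congr rfl fun g _ => this g, Finset.sum_sub_distrib, ← Finset.mul_sum,
      ← Finset.mul_sum, hf0, hsum1]
    have : 0 ≤ m := by positivity
    nlinarith [Nat.cast_nonneg (α := ℝ) S.card]
  have hdec : (fun g => if g ∈ S then (1 : ℝ) else 0) = f + m • fun _ => (1 : ℝ) := by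
    ext g; simp [hf]
  have h1 : ∑ h ∈ T, K f h ≤ L * Real.sqrt (S.card * T.card) := by
    have h2 : (∑ h ∈ T, K f h) ^ 2 ≤ T.card * (L ^ 2 * S.card) := by
      calc _ ≤ T.card * ∑ h ∈ T, K f h ^ 2 := sq_sum_le_card_mul_sum_sq
        _ ≤ T.card * ∑ h, K f h ^ 2 := by
          gcongr
          exact Finset.subset_univ T
        _ ≤ _ := by
          gcongr
          exact (hK f hf0).trans (by gcongr)
    refine le_of_sq_le_sq ?_ (by positivity)
    rw [mul_pow, Real.sq_sqrt (by positivity)]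
    linarith
  rw [hdec, map_add, map_smul]
  simp only [Pi.add_apply, Pi.smul_apply, hK1, smul_eq_mul, Finset.sum_add_distrib,
    Finset.sum_const, nsmul_eq_mul]
  have : (T.card : ℝ) * (m * D) = D * S.card * T.card / n := by simp only [m]; ring
  linarith

end Spectral

/-! ### Minimum distance, puncturing and robustness of the component codes. -/

section LocalCodes

variable {I J : Type*} [Fintype I] [Fintype J]

theorem minDist_le_hammingNorm {C : Submodule (ZMod 2) (I → ZMod 2)} {x : I → ZMod 2}
    (hx : x ∈ C) (h0 : x ≠ 0) : minDist C ≤ hammingNorm x :=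
  Nat.sInf_le ⟨x, hx, h0, rfl⟩

/-- The infimum of the empty set of naturals is 0, so a nonzero value is attained. -/
theorem exists_minDist {C : Submodule (ZMod 2) (I → ZMod 2)} (h : minDist C ≠ 0) :
    ∃ x ∈ C, x ≠ 0 ∧ hammingNorm x = minDist C :=
  Nat.sInf_mem (Nat.nonempty_of_sInf_eq_succ (Nat.succ_pred_eq_of_ne_zero h).symm)

/-- A codeword that vanishes off fewer than `minDist C` coordinates is zero. -/
theorem eq_zero_of_vanish [DecidableEq I] {C : Submodule (ZMod 2) (I → ZMod 2)} {x : I → ZMod 2} (hx : x ∈ C)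
    {I₀ : Finset I} (hI : I₀ᶜ.card < minDist C) (h : ∀ i ∈ I₀, x i = 0) : x = 0 := by
  by_contra h0
  have h1 := minDist_le_hammingNorm hx h0
  have h2 : hammingNorm x ≤ I₀ᶜ.card := by
    refine Finset.card_le_card fun i hi => ?_
    rw [Finset.mem_compl]
    exact fun hi' => (Finset.mem_filter.1 hi).2 (h i hi')
  omega

/-- Reconstruction of a codeword from its values off fewer than `minDist C` coordinates. -/
theorem exists_coeff_of_card_compl_lt [DecidableEq I] {C : Submodule (ZMod 2) (I → ZMod 2)} {I₀ : Finset I}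
    (hI : I₀ᶜ.card < minDist C) :
    ∃ e : I → I₀ → ZMod 2, ∀ x ∈ C, ∀ i, x i = ∑ k : I₀, e i k * x k := by
  let π : C →ₗ[ZMod 2] (I₀ → ZMod 2) :=
    (LinearMap.funLeft (ZMod 2) (ZMod 2) (fun i : I₀ => (i : I))).comp C.subtype
  have hπ : LinearMap.ker π = ⊥ := by
    rw [LinearMap.ker_eq_bot']
    intro x hx
    exact Subtype.ext (eq_zero_of_vanish x.2 hI fun i hi => congrFun hx ⟨i, hi⟩)
  obtain ⟨g, hg⟩ := π.exists_leftInverse_of_injective hπ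
  refine ⟨fun i k => (g (fun j => if k = j then 1 else 0) : I → ZMod 2) i, fun x hx i => ?_⟩
  have h1 : g (π ⟨x, hx⟩) = ⟨x, hx⟩ := LinearMap.congr_fun hg ⟨x, hx⟩
  have h2 : (g (π ⟨x, hx⟩) : I → ZMod 2) i = x i := by rw [h1]
  rw [← h2, LinearMap.pi_apply_eq_sum_univ g]
  simp only [Submodule.coe_sum, Submodule.coe_smul, Finset.sum_apply, Pi.smul_apply, smul_eq_mul]
  exact Finset.sum_congr rfl fun k _ => mul_comm _ _

/-- If a matrix `c` with columns in `CI` and a matrix `r` with rows in `CJ` agree on a large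
subarray, then the common subarray extends to a tensor codeword. -/
theorem exists_tensor_of_agree [DecidableEq I] [DecidableEq J] {CI : Submodule (ZMod 2) (I → ZMod 2)}
    {CJ : Submodule (ZMod 2) (J → ZMod 2)} {c r : I × J → ZMod 2} (hc : c ∈ colCode CI J)
    (hr : r ∈ rowCode I CJ) {I₀ : Finset I} {J₀ : Finset J} (hI : I₀ᶜ.card < minDist CI)
    (hJ : J₀ᶜ.card < minDist CJ) (h : ∀ i ∈ I₀, ∀ j ∈ J₀, c (i, j) = r (i, j)) :
    ∃ t ∈ colCode CI J, t ∈ rowCode I CJ ∧ (∀ j ∈ J₀, ∀ i, c (i, j) = t (i, j)) ∧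
      ∀ i ∈ I₀, ∀ j, r (i, j) = t (i, j) := by
  obtain ⟨e, he⟩ := exists_coeff_of_card_compl_lt hI
  obtain ⟨f, hf⟩ := exists_coeff_of_card_compl_lt hJ
  -- Row i of c is a fixed combination of its rows in I₀. On J₀ these agree with rows of r, and the
  -- same combination of the full rows of r lies in CJ.
  have hex : ∀ i, ∃ y ∈ CJ, ∀ j ∈ J₀, y j = c (i, j) := by
    intro i
    refine ⟨∑ k : I₀, e i k • fun j => r (k, j),
      CJ.sum_mem fun k _ => CJ.smul_mem _ (hr k), fun j hj => ?_⟩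
    rw [he _ (hc j) i, Finset.sum_apply]
    refine Finset.sum_congr rfl fun k _ => ?_
    simp [h k k.2 j hj]
  choose y hy hyc using hex
  have hcol : ∀ j ∈ J₀, ∀ i, c (i, j) = y i j := fun j hj i => (hyc i j hj).symm
  refine ⟨fun ij => y ij.1 ij.2, fun j => ?_, fun i => hy i, hcol, fun i hi j => ?_⟩
  -- Reconstruction in CJ, with coefficients independent of the row, makes every column of y a
  -- combination of the columns of c in J₀.
  · have : (fun i => y i j) = ∑ k : J₀, f j k • fun i => c (i, k) := by
      ext i
      rw [hf _ (hy i) j, Finset.sum_apply]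
      refine Finset.sum_congr rfl fun k _ => ?_
      simp [hyc i k k.2]
    change (fun i => y i j) ∈ CI
    rw [this]
    exact CI.sum_mem fun k _ => CI.smul_mem _ (hc k)
  · have h0 : (fun j => r (i, j)) - y i = 0 := by
      refine eq_zero_of_vanish (CJ.sub_mem (hr i) (hy i)) hJ fun j hj => ?_
      simp [hyc i j hj, h i hi j hj]
    exact sub_eq_zero.1 (congrFun h0 j)

/-- Puncturing `w` coordinates lowers the minimum distance by at most `w`. -/
theorem minDist_le_minDist_puncture_add [DecidableEq I] {C : Submodule (ZMod 2) (I → ZMod 2)} {I' : Finset I}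
    (hI : I'ᶜ.card < minDist C) : minDist C ≤ minDist (puncture C I') + I'ᶜ.card := by
  obtain ⟨x₀, hx₀, hne, -⟩ := exists_minDist (C := C) (by omega)
  -- The punctured code needs a nonzero word, so that its minimum distance is attained rather than
  -- the default value 0.
  have hne' : ∃ n, n ∈ {n : ℕ | ∃ x ∈ puncture C I', x ≠ 0 ∧ hammingNorm x = n} :=
    ⟨_, _, ⟨x₀, hx₀, rfl⟩, fun h0 => hne (eq_zero_of_vanish hx₀ hI fun i hi =>
      congrFun h0 ⟨i, hi⟩), rfl⟩
  obtain ⟨x', ⟨x, hx, rfl⟩, hx0, hxn⟩ := Nat.sInf_mem hne'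
  change hammingNorm _ = minDist (puncture C I') at hxn
  rw [← hxn]
  have h0 : x ≠ 0 := by rintro rfl; simp at hx0
  refine (minDist_le_hammingNorm hx h0).trans ?_
  have hsub : (Finset.univ.filter fun i => x i ≠ 0) ⊆
      ((Finset.univ.filter fun i : I' => x i ≠ 0).image fun i : I' => (i : I)) ∪ I'ᶜ := by
    intro i hi
    rw [Finset.mem_union, Finset.mem_compl]
    by_cases h : i ∈ I'
    · exact Or.inl (Finset.mem_image.2 ⟨⟨i, h⟩, by simpa using hi, rfl⟩)
    · exact Or.inr h
  refine (Finset.card_le_card hsub).trans ((Finset.card_union_le _ _).trans ?_)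
  exact Nat.add_le_add_right Finset.card_image_le _

/-- If the sum of a matrix with columns in `CI` and a matrix with rows in `CJ` has small weight on
a subarray with few rows and columns removed, then the two can be modified by a tensor codeword
to have few nonzero columns and rows respectively. -/
theorem exists_tensor_of_robust [DecidableEq I] [DecidableEq J] {CI : Submodule (ZMod 2) (I → ZMod 2)}
    {CJ : Submodule (ZMod 2) (J → ZMod 2)} {w p d : ℝ} (hrob : IsRobustResistant CI CJ w p)
    (hdI : d ≤ minDist CI) (hdJ : d ≤ minDist CJ)
    {c r : I × J → ZMod 2} (hc : c ∈ colCode CI J)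
    (hr : r ∈ rowCode I CJ) {I' : Finset I} {J' : Finset J} {w' : ℕ}
    (hI : I'ᶜ.card = w') (hJ : J'ᶜ.card = w') (hp : (w' : ℝ) ≤ p) (hwd : (w' : ℝ) < d) {m : ℝ}
    (hm : (((I' ×ˢ J').filter fun ij => c ij + r ij ≠ 0).card : ℝ) ≤ m) (hmw : m ≤ w)
    (hmd : w' + m / (d - w') < d) :
    ∃ t ∈ colCode CI J, t ∈ rowCode I CJ ∧ (colNorm (c + t) : ℝ) ≤ w' + m / (d - w') ∧
      (rowNorm (r + t) : ℝ) ≤ w' + m / (d - w') := by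
  have hcI : I'.card + w' = Fintype.card I := by rw [← hI, Finset.card_add_card_compl]
  have hcJ : J'.card + w' = Fintype.card J := by rw [← hJ, Finset.card_add_card_compl]
  have hr' := hrob I' J' w' hp hcI hcJ
  have hwI : I'ᶜ.card < minDist CI := by
    rw [hI]; exact_mod_cast hwd.trans_le hdI
  have hwJ : J'ᶜ.card < minDist CJ := by
    rw [hJ]; exact_mod_cast hwd.trans_le hdJ
  have hpI : d - w' ≤ minDist (puncture CI I') := by
    have := minDist_le_minDist_puncture_add hwI
    rw [hI] at this
    have : (minDist CI : ℝ) ≤ minDist (puncture CI I') + w' := by exact_mod_cast this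
    linarith
  have hpJ : d - w' ≤ minDist (puncture CJ J') := by
    have := minDist_le_minDist_puncture_add hwJ
    rw [hJ] at this
    have : (minDist CJ : ℝ) ≤ minDist (puncture CJ J') + w' := by exact_mod_cast this
    linarith
  have hpos : 0 < d - w' := by linarith
  let y : I' × J' → ZMod 2 := fun ij => c (ij.1, ij.2) + r (ij.1, ij.2)
  have hy : y ∈ dualTensorCode (puncture CI I') (puncture CJ J') := by
    refine Submodule.add_mem_sup (s := fun ij : I' × J' => c (ij.1, ij.2))
      (t := fun ij : I' × J' => r (ij.1, ij.2))
      ?_ ?_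
    · exact fun j => ⟨_, hc j, rfl⟩
    · exact fun i => ⟨_, hr i, rfl⟩
  have hyn : (hammingNorm y : ℝ) ≤ m := by
    refine le_trans ?_ hm
    norm_cast
    refine Finset.card_le_card_of_injOn (fun ij => ((ij.1 : I), (ij.2 : J))) ?_ ?_
    · intro ij hij
      have h1 := (Finset.mem_filter.1 hij).2
      simp only [Finset.coe_filter, Finset.mem_product, Set.mem_ofPred_eq]
      exact ⟨⟨ij.1.2, ij.2.2⟩, h1⟩
    · rintro ⟨a, b⟩ - ⟨a', b'⟩ - h
      simp only [Prod.mk.injEq] at h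
      exact Prod.ext (Subtype.ext h.1) (Subtype.ext h.2)
  obtain ⟨I'', J'', hI'', hJ'', hvan⟩ := hr' y hy (hyn.trans hmw)
  have hm0 : (0 : ℝ) ≤ m := le_trans (Nat.cast_nonneg _) hyn
  have hI2 : (I''.card : ℝ) ≤ m / (d - w') := hI''.trans (by gcongr)
  have hJ2 : (J''.card : ℝ) ≤ m / (d - w') := hJ''.trans (by gcongr)
  -- Discarding also the rows and columns found by robustness leaves a subarray on which c + r
  -- vanishes, so that c = r there in characteristic 2.
  set I₀ : Finset I := I' \ I''.image Subtype.val with hI₀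
  set J₀ : Finset J := J' \ J''.image Subtype.val with hJ₀
  have hcI₀ : (I₀ᶜ.card : ℝ) ≤ w' + m / (d - w') := by
    have h1 : I₀ᶜ ⊆ I'ᶜ ∪ I''.image Subtype.val := by
      intro i; simp only [hI₀, Finset.mem_compl, Finset.mem_sdiff, Finset.mem_union]; tauto
    have h2 : I₀ᶜ.card ≤ w' + I''.card := by
      refine (Finset.card_le_card h1).trans ((Finset.card_union_le _ _).trans ?_)
      rw [hI]; exact Nat.add_le_add_left Finset.card_image_le _
    have h3 : (I₀ᶜ.card : ℝ) ≤ w' + I''.card := by exact_mod_cast h2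
    linarith
  have hcJ₀ : (J₀ᶜ.card : ℝ) ≤ w' + m / (d - w') := by
    have h1 : J₀ᶜ ⊆ J'ᶜ ∪ J''.image Subtype.val := by
      intro i; simp only [hJ₀, Finset.mem_compl, Finset.mem_sdiff, Finset.mem_union]; tauto
    have h2 : J₀ᶜ.card ≤ w' + J''.card := by
      refine (Finset.card_le_card h1).trans ((Finset.card_union_le _ _).trans ?_)
      rw [hJ]; exact Nat.add_le_add_left Finset.card_image_le _
    have h3 : (J₀ᶜ.card : ℝ) ≤ w' + J''.card := by exact_mod_cast h2
    linarith
  obtain ⟨t, ht, ht', htc, htr⟩ := exists_tensor_of_agree hc hr (I₀ := I₀) (J₀ := J₀)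
    (by have := (hcI₀.trans_lt hmd).trans_le hdI; exact_mod_cast this)
    (by have := (hcJ₀.trans_lt hmd).trans_le hdJ; exact_mod_cast this) (by
      intro i hi j hj
      rw [hI₀, Finset.mem_sdiff] at hi
      rw [hJ₀, Finset.mem_sdiff] at hj
      have := hvan ⟨i, hi.1⟩ ⟨j, hj.1⟩
        (fun h => hi.2 (Finset.mem_image_of_mem _ h)) (fun h => hj.2 (Finset.mem_image_of_mem _ h))
      exact CharTwo.add_eq_zero.1 this)
  refine ⟨t, ht, ht', le_trans ?_ hcJ₀, le_trans ?_ hcI₀⟩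
  · norm_cast
    refine Finset.card_le_card fun j hj => ?_
    obtain ⟨i, hi⟩ := (Finset.mem_filter.1 hj).2
    rw [Finset.mem_compl]
    intro hj'
    exact hi (by rw [Pi.add_apply, htc j hj' i, CharTwo.add_self_eq_zero])
  · norm_cast
    refine Finset.card_le_card fun i hi => ?_
    obtain ⟨j, hj⟩ := (Finset.mem_filter.1 hi).2
    rw [Finset.mem_compl]
    intro hi'
    exact hj (by rw [Pi.add_apply, htr i hi' j, CharTwo.add_self_eq_zero])

open Classical in
theorem hammingNorm_add_add_two_mul (z y : I → ZMod 2) :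
    hammingNorm (z + y) + 2 * (Finset.univ.filter fun i => y i ≠ 0 ∧ z i ≠ 0).card =
      hammingNorm z + hammingNorm y := by
  simp only [hammingNorm, Finset.card_filter, Finset.mul_sum, ← Finset.sum_add_distrib]
  refine Finset.sum_congr rfl fun i _ => ?_
  have : ∀ a b : ZMod 2, (if (a + b) ≠ 0 then 1 else 0) + 2 * (if b ≠ 0 ∧ a ≠ 0 then 1 else 0) =
    (if a ≠ 0 then 1 else 0) + if b ≠ 0 then 1 else 0 := by decide
  convert! this (z i) (y i)

end LocalCodes

/-! ### Incidence of local views, double counting, and the stalling inequality. -/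

section Neighbours

theorem fin_two_eq_or_eq_add_one : ∀ i i' : Fin 2, i = i' ∨ i = i' + 1 := by decide

variable {G : Type*} [Group G] {A B : Finset G}

/-- The vertex of the other row index that shares the column `b` of the array with a vertex of
row index `i`. -/
def colNbr (i : Fin 2) (b : G) : Equiv.Perm G :=
  if i = 0 then Equiv.mulRight b else Equiv.mulRight b⁻¹

/-- The vertex of the other column index that shares the row `a` of the array with a vertex of
column index `j`. -/
def rowNbr (j : Fin 2) (a : G) : Equiv.Perm G :=
  if j = 0 then Equiv.mulLeft a else Equiv.mulLeft a⁻¹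

/-- A square carries the same label at all its corners. The neighbour depends on `b` alone, so the
whole column `b` is shared. -/
theorem label_colNbr (g : G) (i j : Fin 2) (a : A) (b : B) :
    label (colNbr i (b : G) g, i + 1, j) (a, b) = label (g, i, j) (a, b) := by
  fin_cases i <;> fin_cases j <;> simp [label, colNbr, mul_assoc]

theorem label_rowNbr (g : G) (i j : Fin 2) (a : A) (b : B) :
    label (rowNbr j (a : G) g, i, j + 1) (a, b) = label (g, i, j) (a, b) := by
  fin_cases i <;> fin_cases j <;> simp [label, rowNbr, mul_assoc]

/-- Every square has exactly one vertex in `V_{ij}`. -/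
theorem label_bijective (i j : Fin 2) :
    Function.Bijective fun p : G × (A × B) => (label (p.1, i, j) p.2 : Square A B) := by
  constructor
  · rintro ⟨g, a, b⟩ ⟨g', a', b'⟩ h
    fin_cases i <;> fin_cases j <;>
      (simp [label] at h ⊢
       obtain ⟨h1, rfl, rfl⟩ := h
       simpa using h1)
  · rintro ⟨g, a, b⟩
    fin_cases i <;> fin_cases j
    · exact ⟨(g, a, b), rfl⟩
    · exact ⟨(a * g, a, b), by simp [label]⟩
    · exact ⟨(g * b, a, b), by simp [label]⟩
    · exact ⟨(a * g * b, a, b), by simp [label, mul_assoc]⟩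

theorem view_add (v : Vertex G) (x y : Square A B → ZMod 2) :
    view v (x + y) = view v x + view v y := rfl

theorem view_pad_self (v : Vertex G) (y : A × B → ZMod 2) : view v (pad v y) = y := by
  ext ab
  exact (label_injective v).extend_apply y 0 ab

theorem view_pad_of_ne {g h : G} (hgh : h ≠ g) (i j : Fin 2) (y : A × B → ZMod 2) :
    view (h, i, j) (pad (g, i, j) y) = 0 := by
  ext ab
  refine Function.extend_apply' _ _ _ ?_
  rintro ⟨ab', h'⟩
  exact hgh (congrArg Prod.fst ((label_bijective i j).1 (a₁ := (g, ab')) (a₂ := (h, ab)) h')).symm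

/-- Column b at a vertex is column b at its neighbour across the edge, so the column condition
passes from one end to the other. -/
theorem view_mem_colCode_add_one {CA : Submodule (ZMod 2) (A → ZMod 2)}
    {x : Square A B → ZMod 2} {i j : Fin 2} (h : ∀ g, view (g, i, j) x ∈ colCode CA B) (g : G) :
    view (g, i + 1, j) x ∈ colCode CA B := by
  intro b
  have hi : i + 1 + 1 = i := by fin_cases i <;> rfl
  have := h (colNbr (i + 1) (b : G) g) b
  convert! this using 2 with a
  simp only [view]
  rw [← label_colNbr, hi]

theorem view_mem_rowCode_add_one {CB : Submodule (ZMod 2) (B → ZMod 2)}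
    {x : Square A B → ZMod 2} {i j : Fin 2} (h : ∀ g, view (g, i, j) x ∈ rowCode A CB) (g : G) :
    view (g, i, j + 1) x ∈ rowCode A CB := by
  intro a
  have hj : j + 1 + 1 = j := by fin_cases j <;> rfl
  have := h (rowNbr (j + 1) (a : G) g) a
  convert! this using 2 with b
  simp only [view]
  rw [← label_rowNbr, hj]

variable [Fintype G]

-- For fixed b, passing to the neighbour permutes G and preserves column b. The predicate P records
-- a condition on the V_{ij} end of the column.
open Classical in
theorem sum_card_columns (x : Square A B → ZMod 2) (i j : Fin 2) (P : G → Prop) :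
    ∑ h, (Finset.univ.filter fun b : B =>
        (∃ a, view (h, i + 1, j) x (a, b) ≠ 0) ∧ P (colNbr (i + 1) (b : G) h)).card =
      ∑ g, (Finset.univ.filter fun b : B => (∃ a, view (g, i, j) x (a, b) ≠ 0) ∧ P g).card := by
  have hi : i + 1 + 1 = i := by fin_cases i <;> rfl
  simp only [Finset.card_filter]
  rw [Finset.sum_comm, Finset.sum_comm (s := Finset.univ (α := G))]
  refine Finset.sum_congr rfl fun b _ => ?_
  refine Eq.trans ?_ (Equiv.sum_comp (colNbr (i + 1) (b : G)) _)
  refine Finset.sum_congr rfl fun h _ => ?_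
  have : ∀ a, view (h, i + 1, j) x (a, b) = view (colNbr (i + 1) (b : G) h, i, j) x (a, b) := by
    intro a
    simp only [view]
    rw [← label_colNbr h, hi]
  simp only [this]

open Classical in
theorem sum_card_rows (x : Square A B → ZMod 2) (i j : Fin 2) (P : G → Prop) :
    ∑ h, (Finset.univ.filter fun a : A =>
        (∃ b, view (h, i, j + 1) x (a, b) ≠ 0) ∧ P (rowNbr (j + 1) (a : G) h)).card =
      ∑ g, (Finset.univ.filter fun a : A => (∃ b, view (g, i, j) x (a, b) ≠ 0) ∧ P g).card := by
  have hj : j + 1 + 1 = j := by fin_cases j <;> rfl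
  simp only [Finset.card_filter]
  rw [Finset.sum_comm, Finset.sum_comm (s := Finset.univ (α := G))]
  refine Finset.sum_congr rfl fun a _ => ?_
  refine Eq.trans ?_ (Equiv.sum_comp (rowNbr (j + 1) (a : G)) _)
  refine Finset.sum_congr rfl fun h _ => ?_
  have : ∀ b, view (h, i, j + 1) x (a, b) = view (rowNbr (j + 1) (a : G) h, i, j) x (a, b) := by
    intro b
    simp only [view]
    rw [← label_rowNbr h, hj]
  simp only [this]

theorem sum_colNorm_eq (x : Square A B → ZMod 2) (i i' j : Fin 2) :
    ∑ g, colNorm (view (g, i, j) x) = ∑ g, colNorm (view (g, i', j) x) := by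
  have h : ∀ i, ∑ g, colNorm (view (g, i + 1, j) x) = ∑ g, colNorm (view (g, i, j) x) := by
    intro i
    simpa [colNorm] using sum_card_columns x i j fun _ => True
  rcases fin_two_eq_or_eq_add_one i i' with rfl | rfl
  · rfl
  · exact h i'

theorem sum_rowNorm_eq (x : Square A B → ZMod 2) (i j j' : Fin 2) :
    ∑ g, rowNorm (view (g, i, j) x) = ∑ g, rowNorm (view (g, i, j') x) := by
  have h : ∀ j, ∑ g, rowNorm (view (g, i, j + 1) x) = ∑ g, rowNorm (view (g, i, j) x) := by
    intro j
    simpa [rowNorm] using sum_card_rows x i j fun _ => True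
  rcases fin_two_eq_or_eq_add_one j j' with rfl | rfl
  · rfl
  · exact h j'

theorem sum_hammingNorm_view (x : Square A B → ZMod 2) (i j : Fin 2) :
    ∑ g, hammingNorm (view (g, i, j) x) = hammingNorm x := by
  classical
  have h := (label_bijective (A := A) (B := B) i j).sum_comp
    (fun q => if x q ≠ 0 then 1 else 0)
  simp only [hammingNorm, Finset.card_filter]
  rw [← h, Fintype.sum_prod_type]
  rfl

/-- Changing one summand, written without subtraction in the naturals. -/
theorem sum_add_eq_of_eq_off {ι : Type*} [Fintype ι] {f f' : ι → ℕ} (g : ι) (h : ∀ x ≠ g, f' x = f x) :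
    ∑ x, f' x + f g = ∑ x, f x + f' g := by
  classical
  rw [← Finset.add_sum_erase _ f (Finset.mem_univ g),
    ← Finset.add_sum_erase _ f' (Finset.mem_univ g),
    Finset.sum_congr rfl fun x hx => h x (Finset.ne_of_mem_erase hx)]
  ring

open Classical in
/-- At a mismatch where the sequential decoder is stalled, every local codeword has at least half
of its support off the support of the mismatch. -/
theorem IsStalled.hammingNorm_le {CA : Submodule (ZMod 2) (A → ZMod 2)}
    {CB : Submodule (ZMod 2) (B → ZMod 2)} {Z : Square A B → ZMod 2} (hZ : IsStalled CA CB Z)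
    (g : G) (k : Fin 2) {c r : A × B → ZMod 2} (hc : c ∈ colCode CA B) (hr : r ∈ rowCode A CB) :
    hammingNorm (c + r) ≤ 2 * (Finset.univ.filter fun ab =>
      (c + r) ab ≠ 0 ∧ view (g, k, k) Z ab = 0).card := by
  set y := c + r
  have h1 : hammingNorm Z ≤ hammingNorm (Z + pad (g, k, k) y) := by
    by_contra! h
    exact hZ ⟨_, (g, k, k), by simp [V0], c, hc, r, hr, rfl, h⟩
  -- The views at V_{kk} partition the squares, and the update changes only the one at g.
  rw [← sum_hammingNorm_view Z k k, ← sum_hammingNorm_view (Z + _) k k] at h1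
  have h2 := sum_add_eq_of_eq_off (f := fun h => hammingNorm (view (h, k, k) Z))
    (f' := fun h => hammingNorm (view (h, k, k) (Z + pad (g, k, k) y))) g (by
      intro h hne
      rw [view_add, view_pad_of_ne hne, add_zero])
  have h3 := hammingNorm_add_add_two_mul (view (g, k, k) Z) y
  rw [view_add, view_pad_self] at h2
  have h4 : hammingNorm y =
      (Finset.univ.filter fun ab => y ab ≠ 0 ∧ view (g, k, k) Z ab ≠ 0).card +
      (Finset.univ.filter fun ab => y ab ≠ 0 ∧ view (g, k, k) Z ab = 0).card := by
    rw [← Finset.filter_filter, ← Finset.filter_filter, add_comm,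
      Finset.card_filter_add_card_filter_not]
    unfold hammingNorm
    congr!
  omega

end Neighbours

/-! ### Decompositions and local minimality. -/

section Decompositions

variable {G : Type*} [Group G] {A B : Finset G} {CA : Submodule (ZMod 2) (A → ZMod 2)}
  {CB : Submodule (ZMod 2) (B → ZMod 2)}

/-- The columns of C_j are shared by V_{0j} and V_{1j}, so the defining condition at one of the two
holds at both. -/
theorem Decomposition.view_C_mem (D : Decomposition CA CB) (i j : Fin 2) (g : G) :
    view (g, i, j) (D.C j) ∈ colCode CA B := by
  fin_cases i <;> fin_cases j
  · exact view_mem_colCode_add_one D.C0_mem g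
  · exact D.C1_mem g
  · exact D.C0_mem g
  · exact view_mem_colCode_add_one D.C1_mem g

theorem Decomposition.view_R_mem (D : Decomposition CA CB) (i j : Fin 2) (g : G) :
    view (g, i, j) (D.R i) ∈ rowCode A CB := by
  fin_cases i <;> fin_cases j
  · exact view_mem_rowCode_add_one D.R0_mem g
  · exact D.R0_mem g
  · exact D.R1_mem g
  · exact view_mem_rowCode_add_one D.R1_mem g

theorem Decomposition.total_eq (D : Decomposition CA CB) (i j : Fin 2) :
    D.total = D.C j + D.R i + (D.C (j + 1) + D.R (i + 1)) := by
  fin_cases i <;> fin_cases j <;> simp [Decomposition.total] <;> abel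

theorem view_pad_mem {g : G} {i j : Fin 2} {y : A × B → ZMod 2}
    {U : Submodule (ZMod 2) (A × B → ZMod 2)} (hy : y ∈ U) (h : G) :
    view (h, i, j) (pad (g, i, j) y) ∈ U := by
  by_cases hh : h = g
  · rw [hh, view_pad_self]; exact hy
  · rw [view_pad_of_ne hh]; exact U.zero_mem

/-- Addition of a local tensor codeword, at the vertex `(g, i, j)`, to the words `C_j` and `R_i`
of a decomposition. -/
noncomputable def Decomposition.shift (D : Decomposition CA CB) (g : G) (i j : Fin 2)
    {t : A × B → ZMod 2} (hc : t ∈ colCode CA B) (hr : t ∈ rowCode A CB) :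
    Decomposition CA CB :=
  have hC : ∀ i' j' h, view (h, i', j') (Function.update D.C j (D.C j + pad (g, i, j) t) j') ∈
      colCode CA B := by
    intro i' j' h
    by_cases hj : j' = j
    · subst hj
      rw [Function.update_self, view_add]
      refine add_mem (D.view_C_mem _ _ _) ?_
      rcases fin_two_eq_or_eq_add_one i' i with rfl | rfl
      · exact view_pad_mem hc h
      · exact view_mem_colCode_add_one (view_pad_mem hc) h
    · rw [Function.update_of_ne hj]
      exact D.view_C_mem _ _ _
  have hR : ∀ i' j' h, view (h, i', j') (Function.update D.R i (D.R i + pad (g, i, j) t) i') ∈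
      rowCode A CB := by
    intro i' j' h
    by_cases hi : i' = i
    · subst hi
      rw [Function.update_self, view_add]
      refine add_mem (D.view_R_mem _ _ _) ?_
      rcases fin_two_eq_or_eq_add_one j' j with rfl | rfl
      · exact view_pad_mem hr h
      · exact view_mem_rowCode_add_one (view_pad_mem hr) h
    · rw [Function.update_of_ne hi]
      exact D.view_R_mem _ _ _
  { C := Function.update D.C j (D.C j + pad (g, i, j) t)
    R := Function.update D.R i (D.R i + pad (g, i, j) t)
    C0_mem := hC 1 0
    R1_mem := hR 1 0
    C1_mem := hC 0 1
    R0_mem := hR 0 1 }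

theorem Decomposition.shift_total (D : Decomposition CA CB) (g : G) (i j : Fin 2)
    {t : A × B → ZMod 2} (hc : t ∈ colCode CA B) (hr : t ∈ rowCode A CB) :
    (D.shift g i j hc hr).total = D.total := by
  have hne : ∀ i : Fin 2, i + 1 ≠ i := by decide
  rw [Decomposition.total_eq _ i j, D.total_eq i j]
  simp only [Decomposition.shift, Function.update_self, Function.update_of_ne (hne _)]
  have : pad (g, i, j) t + pad (g, i, j) t = 0 :=
    funext fun _ => CharTwo.add_self_eq_zero _
  calc _ = D.C j + D.R i + (pad (g, i, j) t + pad (g, i, j) t) +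
      (D.C (j + 1) + D.R (i + 1)) := by abel
    _ = _ := by rw [this, add_zero]

variable [Fintype G]

/-- The first bracket is read at V_{ij}, and it is all that a shift at a vertex of V_{ij} changes.
-/
theorem Decomposition.norm_eq (D : Decomposition CA CB) (i j : Fin 2) :
    D.norm = (∑ g : G, colNorm (view (g, i, j) (D.C j)) + ∑ g : G, rowNorm (view (g, i, j) (D.R i)))
      + (∑ g : G, colNorm (view (g, i, j + 1) (D.C (j + 1))) +
        ∑ g : G, rowNorm (view (g, i + 1, j) (D.R (i + 1)))) := by
  unfold Decomposition.norm
  rw [sum_colNorm_eq (D.C j) i (j + 1) j, sum_colNorm_eq (D.C (j + 1)) i (j + 1 + 1) (j + 1),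
    sum_rowNorm_eq (D.R i) i j (i + 1), sum_rowNorm_eq (D.R (i + 1)) (i + 1) j (i + 1 + 1)]
  fin_cases i <;> fin_cases j <;> simp <;> ring

/-- A minimal decomposition is minimal at every vertex. -/
theorem Decomposition.IsMinimal.le_of_tensor {D : Decomposition CA CB} {Z : Square A B → ZMod 2}
    (hD : D.IsMinimal Z) (g : G) (i j : Fin 2) {t : A × B → ZMod 2} (hc : t ∈ colCode CA B)
    (hr : t ∈ rowCode A CB) :
    colNorm (view (g, i, j) (D.C j)) + rowNorm (view (g, i, j) (D.R i)) ≤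
      colNorm (view (g, i, j) (D.C j) + t) + rowNorm (view (g, i, j) (D.R i) + t) := by
  have hne : ∀ i : Fin 2, i + 1 ≠ i := by decide
  have h := hD.2 (D.shift g i j hc hr) (by rw [D.shift_total, hD.1])
  rw [D.norm_eq i j, (D.shift g i j hc hr).norm_eq i j] at h
  simp only [Decomposition.shift, Function.update_self, Function.update_of_ne (hne _)] at h
  have h1 := sum_add_eq_of_eq_off (f := fun h => colNorm (view (h, i, j) (D.C j)))
    (f' := fun h => colNorm (view (h, i, j) (D.C j + pad (g, i, j) t))) g (by
      intro h hne
      rw [view_add, view_pad_of_ne hne, add_zero])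
  have h2 := sum_add_eq_of_eq_off (f := fun h => rowNorm (view (h, i, j) (D.R i)))
    (f' := fun h => rowNorm (view (h, i, j) (D.R i + pad (g, i, j) t))) g (by
      intro h hne
      rw [view_add, view_pad_of_ne hne, add_zero])
  rw [view_add (g, i, j), view_pad_self] at h1 h2
  omega

end Decompositions

/-! ### Mixing estimates on the square complex. -/

section Mixing

variable {G : Type*} [Group G]

/-- The adjacency operator `f ↦ (g ↦ ∑ₐ f (a g))`, or its version with `a⁻¹`. -/
def rowOp (A : Finset G) (j : Fin 2) : (G → ℝ) →ₗ[ℝ] (G → ℝ) where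
  toFun f g := ∑ a : A, f (rowNbr j (a : G) g)
  map_add' f f' := by ext g; simp [Finset.sum_add_distrib]
  map_smul' c f := by ext g; simp [Finset.mul_sum]

/-- The adjacency operator `f ↦ (g ↦ ∑_b f (g b))`, or its version with `b⁻¹`. -/
def colOp (B : Finset G) (i : Fin 2) : (G → ℝ) →ₗ[ℝ] (G → ℝ) where
  toFun f g := ∑ b : B, f (colNbr i (b : G) g)
  map_add' f f' := by ext g; simp [Finset.sum_add_distrib]
  map_smul' c f := by ext g; simp [Finset.mul_sum]

theorem sum_inv_eq_sum {A : Finset G} (hA : ∀ a ∈ A, a⁻¹ ∈ A) (F : G → ℝ) :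
    ∑ a ∈ A, F a⁻¹ = ∑ a ∈ A, F a :=
  Finset.sum_nbij' (·⁻¹) (·⁻¹) hA hA (by simp) (by simp) (by simp)

variable {A B : Finset G} {Δ : ℕ} [Fintype G]

theorem sum_rowOp_eq_zero (j : Fin 2) {f : G → ℝ} (hf : ∑ g, f g = 0) :
    ∑ g, rowOp A j f g = 0 := by
  change ∑ g, ∑ a : A, f (rowNbr j (a : G) g) = 0
  rw [Finset.sum_comm]
  exact Finset.sum_eq_zero fun a _ => (Equiv.sum_comp (rowNbr j (a : G)) f).trans hf

/-- As A = A⁻¹, both versions of the operator are the adjacency operator of the left Cayley graph.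
-/
theorem rowOp_sq_le (hG : GoodGenerators A B Δ) (hΔ : 1 ≤ Δ) (j : Fin 2) (f : G → ℝ)
    (hf : ∑ g, f g = 0) :
    ∑ g, rowOp A j f g ^ 2 ≤ (2 * Real.sqrt Δ) ^ 2 * ∑ g, f g ^ 2 := by
  classical
  have hop : ∀ g, rowOp A j f g = ∑ h ∈ A.image (· * g), f h := by
    intro g
    rw [Finset.sum_image fun _ _ _ _ h => mul_right_cancel h]
    change ∑ a : A, f (rowNbr j (a : G) g) = _
    rw [Finset.sum_coe_sort A fun a => f (rowNbr j a g)]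
    fin_cases j
    · simp [rowNbr]
    · simpa [rowNbr] using sum_inv_eq_sum hG.symm_A fun a => f (a * g)
  rw [mul_pow, Real.sq_sqrt (Nat.cast_nonneg _)]
  simp only [hop]
  have h := hG.ramanujan_A.sum_sq_le hΔ (by
      rintro g h ⟨a, ha, rfl⟩
      exact ⟨a⁻¹, hG.symm_A a ha, by simp⟩) (fun g => A.image (· * g)) (by
      intro g h
      simp only [leftCayleyAdj, Finset.mem_image, eq_comm]) (by
      intro g
      rw [Finset.card_image_of_injective _ (mul_left_injective g), hG.card_A]) f hf
  norm_num at h ⊢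
  exact h

theorem colOp_sq_le (hG : GoodGenerators A B Δ) (hΔ : 1 ≤ Δ) (i : Fin 2) (f : G → ℝ)
    (hf : ∑ g, f g = 0) :
    ∑ g, colOp B i f g ^ 2 ≤ (2 * Real.sqrt Δ) ^ 2 * ∑ g, f g ^ 2 := by
  classical
  have hop : ∀ g, colOp B i f g = ∑ h ∈ B.image (g * ·), f h := by
    intro g
    rw [Finset.sum_image fun _ _ _ _ h => mul_left_cancel h]
    change ∑ b : B, f (colNbr i (b : G) g) = _
    rw [Finset.sum_coe_sort B fun b => f (colNbr i b g)]
    fin_cases i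
    · simp [colNbr]
    · simpa [colNbr] using sum_inv_eq_sum hG.symm_B fun b => f (g * b)
  rw [mul_pow, Real.sq_sqrt (Nat.cast_nonneg _)]
  simp only [hop]
  have h := hG.ramanujan_B.sum_sq_le hΔ (by
      rintro g h ⟨b, hb, rfl⟩
      exact ⟨b⁻¹, hG.symm_B b hb, by simp⟩) (fun g => B.image (g * ·)) (by
      intro g h
      simp only [rightCayleyAdj, Finset.mem_image, eq_comm]) (by
      intro g
      rw [Finset.card_image_of_injective _ (mul_right_injective g), hG.card_B]) f hf
  norm_num at h ⊢
  exact h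

open Classical in
theorem sum_card_rowNbr_le (hG : GoodGenerators A B Δ) (hΔ : 1 ≤ Δ) (j : Fin 2) (S T : Finset G) :
    ∑ h ∈ T, ((Finset.univ.filter fun a : A => rowNbr j (a : G) h ∈ S).card : ℝ) ≤
      Δ * S.card * T.card / Fintype.card G + 2 * Real.sqrt Δ * Real.sqrt (S.card * T.card) := by
  refine le_of_eq_of_le ?_ (mixing (rowOp A j) (by positivity) ?_ (rowOp_sq_le hG hΔ j) S T)
  · refine Finset.sum_congr rfl fun h _ => ?_
    simp [rowOp]
  · intro g
    simp [rowOp, hG.card_A]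

open Classical in
theorem sum_card_colNbr_le (hG : GoodGenerators A B Δ) (hΔ : 1 ≤ Δ) (i : Fin 2) (S T : Finset G) :
    ∑ h ∈ T, ((Finset.univ.filter fun b : B => colNbr i (b : G) h ∈ S).card : ℝ) ≤
      Δ * S.card * T.card / Fintype.card G + 2 * Real.sqrt Δ * Real.sqrt (S.card * T.card) := by
  refine le_of_eq_of_le ?_ (mixing (colOp B i) (by positivity) ?_ (colOp_sq_le hG hΔ i) S T)
  · refine Finset.sum_congr rfl fun h _ => ?_
    simp [colOp]
  · intro g
    simp [colOp, hG.card_B]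

-- Each of the two operators contracts mean-zero functions by 2√Δ, and the first preserves mean
-- zero, so the two-step walk to opposite corners contracts by 4Δ.
open Classical in
theorem sum_card_rowNbr_colNbr_le (hG : GoodGenerators A B Δ) (hΔ : 1 ≤ Δ) (i j : Fin 2)
    (S T : Finset G) :
    ∑ h ∈ T, ((Finset.univ.filter fun ab : A × B =>
        rowNbr j (ab.1 : G) (colNbr i (ab.2 : G) h) ∈ S).card : ℝ) ≤
      (Δ : ℝ) ^ 2 * S.card * T.card / Fintype.card G +
        4 * Δ * Real.sqrt (S.card * T.card) := by
  refine le_of_eq_of_le ?_ (mixing ((colOp B i).comp (rowOp A j)) (by positivity) ?_ ?_ S T)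
  · refine Finset.sum_congr rfl fun h _ => ?_
    rw [Finset.card_filter, Fintype.sum_prod_type_right]
    simp [rowOp, colOp]
  · intro g
    simp [rowOp, colOp, hG.card_A, hG.card_B, pow_two]
  · intro f hf
    refine (colOp_sq_le hG hΔ i _ (sum_rowOp_eq_zero j hf)).trans ?_
    have h := rowOp_sq_le hG hΔ j f hf
    have hs : (2 * Real.sqrt Δ) ^ 2 = 4 * (Δ : ℝ) := by
      rw [mul_pow, Real.sq_sqrt (Nat.cast_nonneg _)]; norm_num
    rw [hs] at h ⊢
    calc _ ≤ 4 * (Δ : ℝ) * (4 * (Δ : ℝ) * ∑ g, f g ^ 2) := by gcongr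
      _ = _ := by ring

/-- A set all of whose vertices have many neighbours in `S` is small. -/
theorem card_le_of_mixing {ι : Type*} {T : Finset ι} {c : ι → ℝ} {θ D L n σ : ℝ} (hθ : 0 < θ)
    (hσ : 0 ≤ σ) (hc : ∀ h ∈ T, θ ≤ c h)
    (hmix : ∑ h ∈ T, c h ≤ D * σ * T.card / n + L * Real.sqrt (σ * T.card))
    (hD : D * σ / n ≤ θ / 2) : (T.card : ℝ) ≤ 4 * L ^ 2 * σ / θ ^ 2 := by
  have h1 : θ * T.card ≤ ∑ h ∈ T, c h := by
    have := Finset.sum_le_sum hc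
    simpa [mul_comm] using this
  -- The main term of the mixing bound absorbs at most half of the lower bound; the error term must
  -- carry the rest.
  have h2 : D * σ * T.card / n ≤ θ / 2 * T.card := by
    calc _ = D * σ / n * T.card := by ring
      _ ≤ _ := by gcongr
  have h3 : θ / 2 * T.card ≤ L * Real.sqrt (σ * T.card) := by linarith
  have h4 : (θ / 2 * T.card) ^ 2 ≤ L ^ 2 * (σ * T.card) := by
    calc _ ≤ (L * Real.sqrt (σ * T.card)) ^ 2 := by gcongr
      _ = _ := by rw [mul_pow, Real.sq_sqrt (by positivity)]
  rcases (Nat.cast_nonneg (α := ℝ) T.card).eq_or_lt with h0 | h0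
  · rw [← h0]; positivity
  · rw [le_div_iff₀ (by positivity)]
    have : (T.card : ℝ) * (T.card * θ ^ 2) ≤ T.card * (4 * L ^ 2 * σ) := by nlinarith
    exact le_of_mul_le_mul_left this h0

end Mixing

/-! ### Active and exceptional vertices, and the local bounds at each vertex. -/

section ActiveVertices

variable {G : Type*} [Group G] [Fintype G] {A B : Finset G} {Δ : ℕ}
  {CA : Submodule (ZMod 2) (A → ZMod 2)} {CB : Submodule (ZMod 2) (B → ZMod 2)}

open Classical in
/-- The active vertices in `V_{kk}`. -/
noncomputable def Decomposition.activeAt (D : Decomposition CA CB) (k : Fin 2) : Finset G :=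
  Finset.univ.filter fun g => view (g, k, k) (D.C k + D.R k) ≠ 0

open Classical in
/-- The exceptional vertices in `V_{kk}`: those with a local view of weight more than `τ`. -/
noncomputable def Decomposition.exceptionalAt (D : Decomposition CA CB) (τ : ℝ) (k : Fin 2) :
    Finset G :=
  Finset.univ.filter fun g => τ < hammingNorm (view (g, k, k) (D.C k + D.R k))

theorem Decomposition.card_active (D : Decomposition CA CB) :
    D.active.card = (D.activeAt 0).card + (D.activeAt 1).card := by
  classical
  have h : ∀ v : Vertex G, v ∈ V0 G ↔ v.2.1 = v.2.2 := by simp [V0]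
  have h1 : D.active = (D.activeAt 0).image (fun g => ((g, 0, 0) : Vertex G)) ∪
      (D.activeAt 1).image (fun g => ((g, 1, 1) : Vertex G)) := by
    ext ⟨g, i, j⟩
    simp only [Decomposition.active, Finset.mem_filter, h, Finset.mem_union, Finset.mem_image,
      Decomposition.activeAt, Finset.mem_univ, true_and, Prod.mk.injEq]
    fin_cases i <;> fin_cases j <;> simp [add_comm]
  rw [h1, Finset.card_union_of_disjoint, Finset.card_image_of_injective,
    Finset.card_image_of_injective]
  · exact fun g g' h => congrArg Prod.fst h
  · exact fun g g' h => congrArg Prod.fst h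
  · rw [Finset.disjoint_left]
    intro v hv hv'
    obtain ⟨g, -, rfl⟩ := Finset.mem_image.1 hv
    obtain ⟨g', -, h⟩ := Finset.mem_image.1 hv'
    simp at h

theorem card_V0 (G : Type*) [Fintype G] : (V0 G).card = 2 * Fintype.card G := by
  classical
  have h1 : V0 G = Finset.univ.image (fun p : G × Fin 2 => ((p.1, p.2, p.2) : Vertex G)) := by
    ext ⟨g, i, j⟩
    simp [V0, eq_comm]
  rw [h1, Finset.card_image_of_injective, Finset.card_univ, Fintype.card_prod, Fintype.card_fin,
    mul_comm]
  rintro ⟨g, i⟩ ⟨g', i'⟩ h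
  simp only [Prod.mk.injEq] at h
  exact Prod.ext h.1 h.2.1

open Classical in
/-- A square where the words of `V_{kk}` and the mismatch differ meets an active vertex of the other
part of `V_0`. -/
theorem Decomposition.mem_activeAt_of_ne {D : Decomposition CA CB} {Z : Square A B → ZMod 2}
    (hD : D.total = Z) {k : Fin 2} {g g' : G} {ab : A × B}
    (hl : label (g', k + 1, k + 1) ab = label (g, k, k) ab)
    (h : view (g, k, k) (D.C k + D.R k) ab ≠ view (g, k, k) Z ab) : g' ∈ D.activeAt (k + 1) := by
  rw [Decomposition.activeAt, Finset.mem_filter]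
  refine ⟨Finset.mem_univ _, fun h0 => h ?_⟩
  have h1 : view (g', k + 1, k + 1) (D.C (k + 1) + D.R (k + 1)) ab = 0 := by rw [h0]; rfl
  simp only [view, hl] at h1 ⊢
  rw [← hD, D.total_eq k k, Pi.add_apply (D.C k + D.R k), h1, add_zero]

-- Stalling puts half of the support of the view where Ẑ vanishes, and each such square has an
-- active opposite corner.
open Classical in
theorem Decomposition.hammingNorm_view_le {D : Decomposition CA CB} {Z : Square A B → ZMod 2}
    (hD : D.total = Z) (hZ : IsStalled CA CB Z) (k : Fin 2) (g : G) :
    hammingNorm (view (g, k, k) (D.C k + D.R k)) ≤ 2 * (Finset.univ.filter fun ab : A × B =>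
      rowNbr k (ab.1 : G) (colNbr k (ab.2 : G) g) ∈ D.activeAt (k + 1)).card := by
  refine (hZ.hammingNorm_le g k (D.view_C_mem k k g) (D.view_R_mem k k g)).trans ?_
  refine Nat.mul_le_mul_left 2 (Finset.card_le_card fun ab hab => ?_)
  obtain ⟨h1, h2⟩ := (Finset.mem_filter.1 hab).2
  rw [Finset.mem_filter]
  refine ⟨Finset.mem_univ _, D.mem_activeAt_of_ne hD (g := g) (ab := ab) ?_ ?_⟩
  · exact (label_rowNbr _ (k + 1) k ab.1 ab.2).trans (label_colNbr g k k ab.1 ab.2)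
  · rw [h2]
    exact h1

open Classical in
/-- A nonzero column at a vertex of `V_1`, attached to a vertex of `V_0` that sees few nonzero
rows, provides many active neighbours. -/
theorem Decomposition.le_card_of_column {D : Decomposition CA CB} {Z : Square A B → ZMod 2}
    (hD : D.total = Z) (hZ : IsStalled CA CB Z) (k : Fin 2) (h : G) (b : B)
    (hb : ∃ a, view (h, k + 1, k) (D.C k) (a, b) ≠ 0) :
    minDist CA ≤ 2 * (rowNorm (view (colNbr (k + 1) (b : G) h, k, k) (D.R k)) +
      (Finset.univ.filter fun a : A => rowNbr k (a : G) h ∈ D.activeAt (k + 1)).card) := by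
  set g := colNbr (k + 1) (b : G) h
  have hk : k + 1 + 1 = k := by fin_cases k <;> rfl
  have hlab : ∀ a : A, label (g, k, k) (a, b) = label (h, k + 1, k) (a, b) := by
    intro a
    rw [← label_colNbr h, hk]
  have hlab' : ∀ a : A, label (rowNbr k (a : G) h, k + 1, k + 1) (a, b) = label (g, k, k) (a, b) :=
    fun a => (label_rowNbr h (k + 1) k a b).trans (hlab a).symm
  let x : A → ZMod 2 := fun a => view (g, k, k) (D.C k) (a, b)
  have hx : x ∈ CA := D.view_C_mem k k g b
  have hx0 : x ≠ 0 := by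
    obtain ⟨a, ha⟩ := hb
    intro h0
    apply ha
    have := congrFun h0 a
    simp only [x, view, hlab] at this
    exact this
  -- The single column x is itself a local codeword at g, so stalling applies to it alone.
  let c : A × B → ZMod 2 := fun ab => if ab.2 = b then x ab.1 else 0
  have hc : c ∈ colCode CA B := by
    intro b'
    by_cases hb' : b' = b
    · simpa [c, hb'] using hx
    · simp only [c, hb', if_false]
      exact CA.zero_mem
  have h1 := hZ.hammingNorm_le g k hc (rowCode A CB).zero_mem
  rw [add_zero] at h1
  have h2 : hammingNorm x ≤ hammingNorm c := by
    refine Finset.card_le_card_of_injOn (fun a => (a, b)) ?_ ?_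
    · intro a ha
      simpa [c] using ha
    · intro a _ a' _ haa
      exact congrArg Prod.fst haa
  have h3 : (Finset.univ.filter fun ab : A × B => c ab ≠ 0 ∧ view (g, k, k) Z ab = 0).card ≤
      rowNorm (view (g, k, k) (D.R k)) +
        (Finset.univ.filter fun a : A => rowNbr k (a : G) h ∈ D.activeAt (k + 1)).card := by
    refine le_trans ?_ (Finset.card_union_le _ _)
    refine Finset.card_le_card_of_injOn Prod.fst ?_ ?_
    · rintro ⟨a, b'⟩ hab
      obtain ⟨hcab, hzab⟩ := (Finset.mem_filter.1 hab).2
      obtain rfl : b' = b := by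
        by_contra hne
        simp [c, hne] at hcab
      have hxa : x a ≠ 0 := by simpa [c] using hcab
      rw [Finset.mem_coe, Finset.mem_union, Finset.mem_filter, Finset.mem_filter]
      -- Where R_k vanishes, C_k + R_k equals x(a) ≠ 0 while Ẑ is 0, so the opposite corner is
      -- active; otherwise a is one of the nonzero rows of R_k.
      by_cases hr : view (g, k, k) (D.R k) (a, b') = 0
      · refine Or.inr ⟨Finset.mem_univ _, D.mem_activeAt_of_ne hD (hlab' a) ?_⟩
        rw [hzab, view_add, Pi.add_apply, hr, add_zero]
        exact hxa
      · exact Or.inl ⟨Finset.mem_univ _, b', hr⟩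
    · rintro ⟨a, b₁⟩ h₁ ⟨a', b₂⟩ h₂ haa
      have e₁ := (Finset.mem_filter.1 h₁).2.1
      have e₂ := (Finset.mem_filter.1 h₂).2.1
      simp only [c, ne_eq, ite_eq_right_iff, not_forall] at e₁ e₂
      exact Prod.ext haa (e₁.1.trans e₂.1.symm)
  have h4 := minDist_le_hammingNorm hx hx0
  omega

open Classical in
/-- A nonzero row at a vertex of `V_1`, attached to a vertex of `V_0` that sees few nonzero
columns, provides many active neighbours. -/
theorem Decomposition.le_card_of_row {D : Decomposition CA CB} {Z : Square A B → ZMod 2}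
    (hD : D.total = Z) (hZ : IsStalled CA CB Z) (k : Fin 2) (h : G) (a : A)
    (ha : ∃ b, view (h, k + 1, k) (D.R (k + 1)) (a, b) ≠ 0) :
    minDist CB ≤
      2 * (colNorm (view (rowNbr k (a : G) h, k + 1, k + 1) (D.C (k + 1))) +
        (Finset.univ.filter fun b : B => colNbr (k + 1) (b : G) h ∈ D.activeAt k).card) := by
  set g := rowNbr k (a : G) h
  have hk : k + 1 + 1 = k := by fin_cases k <;> rfl
  have hlab : ∀ b : B, label (g, k + 1, k + 1) (a, b) = label (h, k + 1, k) (a, b) := by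
    intro b
    rw [← label_rowNbr h]
  have hlab' : ∀ b : B, label (colNbr (k + 1) (b : G) h, k + 1 + 1, k + 1 + 1) (a, b) =
      label (g, k + 1, k + 1) (a, b) := by
    intro b
    rw [hlab, ← label_colNbr h (k + 1), hk]
  let x : B → ZMod 2 := fun b => view (g, k + 1, k + 1) (D.R (k + 1)) (a, b)
  have hx : x ∈ CB := D.view_R_mem (k + 1) (k + 1) g a
  have hx0 : x ≠ 0 := by
    obtain ⟨b, hb⟩ := ha
    intro h0
    apply hb
    have := congrFun h0 b
    simp only [x, view, hlab] at this
    exact this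
  let r : A × B → ZMod 2 := fun ab => if ab.1 = a then x ab.2 else 0
  have hr : r ∈ rowCode A CB := by
    intro a'
    by_cases ha' : a' = a
    · simpa [r, ha'] using hx
    · simp only [r, ha', if_false]
      exact CB.zero_mem
  have h1 := hZ.hammingNorm_le g (k + 1) (colCode CA B).zero_mem hr
  rw [zero_add] at h1
  have h2 : hammingNorm x ≤ hammingNorm r := by
    refine Finset.card_le_card_of_injOn (fun b => (a, b)) ?_ ?_
    · intro b hb
      simpa [r] using hb
    · intro b _ b' _ hbb
      exact congrArg Prod.snd hbb
  have h3 : (Finset.univ.filter fun ab : A × B =>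
      r ab ≠ 0 ∧ view (g, k + 1, k + 1) Z ab = 0).card ≤
      colNorm (view (g, k + 1, k + 1) (D.C (k + 1))) +
        (Finset.univ.filter fun b : B => colNbr (k + 1) (b : G) h ∈ D.activeAt k).card := by
    refine le_trans ?_ (Finset.card_union_le _ _)
    refine Finset.card_le_card_of_injOn Prod.snd ?_ ?_
    · rintro ⟨a', b⟩ hab
      obtain ⟨hrab, hzab⟩ := (Finset.mem_filter.1 hab).2
      obtain rfl : a' = a := by
        by_contra hne
        simp [r, hne] at hrab
      have hxb : x b ≠ 0 := by simpa [r] using hrab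
      rw [Finset.mem_coe, Finset.mem_union, Finset.mem_filter, Finset.mem_filter]
      by_cases hc : view (g, k + 1, k + 1) (D.C (k + 1)) (a', b) = 0
      · refine Or.inr ⟨Finset.mem_univ _, ?_⟩
        have := D.mem_activeAt_of_ne hD (hlab' b) (by
          rw [hzab, view_add, Pi.add_apply, hc, zero_add]
          exact hxb)
        rwa [hk] at this
      · exact Or.inl ⟨Finset.mem_univ _, a', hc⟩
    · rintro ⟨a₁, b⟩ h₁ ⟨a₂, b'⟩ h₂ hbb
      have e₁ := (Finset.mem_filter.1 h₁).2.1
      have e₂ := (Finset.mem_filter.1 h₂).2.1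
      simp only [r, ne_eq, ite_eq_right_iff, not_forall] at e₁ e₂
      exact Prod.ext (e₁.1.trans e₂.1.symm) hbb
  have h4 := minDist_le_hammingNorm hx hx0
  omega

/-- The norms of a minimal decomposition at a vertex whose view has small weight on a large
subarray. -/
theorem Decomposition.IsMinimal.norm_le_of_robust [DecidableEq A] [DecidableEq B] {D : Decomposition CA CB}
    {Z : Square A B → ZMod 2} (hD : D.IsMinimal Z) {w p d : ℝ}
    (hrob : IsRobustResistant CA CB w p) (hdA : d ≤ minDist CA) (hdB : d ≤ minDist CB)
    (hcard : A.card = B.card) (g : G) (i j : Fin 2) (EA : Finset A) (EB : Finset B) {w' m : ℝ}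
    (hw' : (EA.card : ℝ) + EB.card ≤ w') (hp : w' ≤ p) (hwd : w' < d)
    (hm : (((EAᶜ ×ˢ EBᶜ).filter fun ab =>
      view (g, i, j) (D.C j) ab + view (g, i, j) (D.R i) ab ≠ 0).card : ℝ) ≤ m)
    (hmw : m ≤ w) (hmd : w' + m / (d - w') < d) :
    (colNorm (view (g, i, j) (D.C j)) : ℝ) + rowNorm (view (g, i, j) (D.R i)) ≤
      2 * (w' + m / (d - w')) := by
  have hm0 : 0 ≤ m := le_trans (Nat.cast_nonneg _) hm
  -- Resistance to puncturing removes equally many rows and columns, so both sets are enlarged to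
  -- this common size.
  set n := EA.card + EB.card with hn
  have hnw : (n : ℝ) ≤ w' := by rw [hn]; push_cast; exact hw'
  have hmono : n + m / (d - n) ≤ w' + m / (d - w') := by
    have : 0 < d - w' := by linarith
    gcongr
  have hnd : (n : ℝ) < minDist CA := lt_of_le_of_lt hnw (hwd.trans_le hdA)
  obtain ⟨x, hx, hx0, hxn⟩ := exists_minDist (C := CA) (by
    intro h0
    rw [h0] at hnd
    have : (0 : ℝ) ≤ n := Nat.cast_nonneg n
    simp only [Nat.cast_zero] at hnd
    linarith)
  have hnA : n ≤ A.card := by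
    have h1 : hammingNorm x ≤ Fintype.card A := hammingNorm_le_card_fintype
    rw [Fintype.card_coe, hxn] at h1
    have : n < minDist CA := by exact_mod_cast hnd
    omega
  obtain ⟨FA, hFA, -, hFAn⟩ := Finset.exists_subsuperset_card_eq (Finset.subset_univ EA)
    (n := n) (by omega) (by simpa using hnA)
  obtain ⟨FB, hFB, -, hFBn⟩ := Finset.exists_subsuperset_card_eq (Finset.subset_univ EB)
    (n := n) (by omega) (by simpa [← hcard] using hnA)
  obtain ⟨t, htc, htr, h1, h2⟩ := exists_tensor_of_robust hrob hdA hdB (D.view_C_mem i j g)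
    (D.view_R_mem i j g) (I' := FAᶜ) (J' := FBᶜ) (w' := n) (m := m)
    (by rw [compl_compl, hFAn]) (by rw [compl_compl, hFBn]) (hnw.trans hp) (hnw.trans_lt hwd)
    (by
      refine le_trans ?_ hm
      norm_cast
      refine Finset.card_le_card (Finset.filter_subset_filter _ ?_)
      exact Finset.product_subset_product (Finset.compl_subset_compl.2 hFA)
        (Finset.compl_subset_compl.2 hFB)) hmw (hmono.trans_lt hmd)
  have h3 := hD.le_of_tensor g i j htc htr
  have h4 : (colNorm (view (g, i, j) (D.C j)) : ℝ) + rowNorm (view (g, i, j) (D.R i)) ≤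
      colNorm (view (g, i, j) (D.C j) + t) + rowNorm (view (g, i, j) (D.R i) + t) := by
    exact_mod_cast h3
  linarith

/-- A nonexceptional vertex sees few nonzero columns and rows of a minimal decomposition. -/
theorem Decomposition.IsMinimal.norm_le_of_notMem {D : Decomposition CA CB}
    {Z : Square A B → ZMod 2} (hD : D.IsMinimal Z) {w p d τ : ℝ}
    (hrob : IsRobustResistant CA CB w p) (hdA : d ≤ minDist CA) (hdB : d ≤ minDist CB)
    (hcard : A.card = B.card) (hp : 0 ≤ p) (hd : 0 < d) (hτw : τ ≤ w) (hτd : τ / d < d)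
    {k : Fin 2} {g : G} (hg : g ∉ D.exceptionalAt τ k) :
    (colNorm (view (g, k, k) (D.C k)) : ℝ) + rowNorm (view (g, k, k) (D.R k)) ≤ 2 * (τ / d) := by
  classical
  have h := hD.norm_le_of_robust hrob hdA hdB hcard g k k ∅ ∅ (w' := 0) (m := τ) (by simp) hp hd
    (by
      simp only [Decomposition.exceptionalAt, Finset.mem_filter, Finset.mem_univ, true_and,
        not_lt] at hg
      refine le_trans ?_ hg
      norm_cast
      refine Finset.card_le_card fun ab hab => ?_
      rw [Finset.mem_filter] at hab ⊢
      exact ⟨Finset.mem_univ _, hab.2⟩) hτw (by simpa using hτd)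
  simpa using h

open Classical in
/-- A vertex of `V_1` with few exceptional neighbours and few mismatched squares sees few nonzero
columns and rows of a minimal decomposition. -/
theorem Decomposition.IsMinimal.norm_le_of_few_exceptional {D : Decomposition CA CB}
    {Z : Square A B → ZMod 2} (hD : D.IsMinimal Z) {w p d τ μ : ℝ}
    (hrob : IsRobustResistant CA CB w p) (hdA : d ≤ minDist CA) (hdB : d ≤ minDist CB)
    (hA : A.card = Δ) (hB : B.card = Δ)
    (hμ0 : 0 ≤ μ) (hμ : ∀ k g, g ∉ D.exceptionalAt τ k →
      (colNorm (view (g, k, k) (D.C k)) : ℝ) + rowNorm (view (g, k, k) (D.R k)) ≤ μ)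
    (k : Fin 2) (h : G)
    (hE : ((Finset.univ.filter fun a : A =>
        rowNbr k (a : G) h ∈ D.exceptionalAt τ (k + 1)).card : ℝ) +
      (Finset.univ.filter fun b : B => colNbr (k + 1) (b : G) h ∈ D.exceptionalAt τ k).card ≤ p)
    (hpd : p < d) (hZ : (hammingNorm (view (h, k + 1, k) Z) : ℝ) + 2 * Δ * μ ≤ w)
    (hmd : p + w / (d - p) < d) :
    (colNorm (view (h, k + 1, k) (D.C k)) : ℝ) + rowNorm (view (h, k + 1, k) (D.R (k + 1))) ≤
      2 * (p + w / (d - p)) := by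
  have hk : k + 1 + 1 = k := by fin_cases k <;> rfl
  refine hD.norm_le_of_robust hrob hdA hdB (hA.trans hB.symm) h (k + 1) k _ _ hE le_rfl hpd
    ?_ le_rfl hmd
  refine le_trans ?_ hZ
  set EA := Finset.univ.filter fun a : A => rowNbr k (a : G) h ∈ D.exceptionalAt τ (k + 1)
  set EB := Finset.univ.filter fun b : B => colNbr (k + 1) (b : G) h ∈ D.exceptionalAt τ k
  have hlabc : ∀ (a : A) (b : B), label (colNbr (k + 1) (b : G) h, k, k) (a, b) =
      label (h, k + 1, k) (a, b) := by
    intro a b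
    rw [← label_colNbr h (k + 1), hk]
  have hlabr : ∀ (a : A) (b : B), label (rowNbr k (a : G) h, k + 1, k + 1) (a, b) =
      label (h, k + 1, k) (a, b) := fun a b => label_rowNbr h (k + 1) k a b
  -- C_k + R_{k+1} is the sum of Ẑ, R_k and C_{k+1}. The last two are read at column and row
  -- neighbours respectively, nonexceptional off EB and EA.
  let P1 : Finset (A × B) := Finset.univ.filter fun ab => view (h, k + 1, k) Z ab ≠ 0
  let P2 : Finset (A × B) := (Finset.univ ×ˢ EBᶜ).filter fun ab =>
    view (h, k + 1, k) (D.R k) ab ≠ 0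
  let P3 : Finset (A × B) := (EAᶜ ×ˢ Finset.univ).filter fun ab =>
    view (h, k + 1, k) (D.C (k + 1)) ab ≠ 0
  have hsub : ((EAᶜ ×ˢ EBᶜ).filter fun ab =>
      view (h, k + 1, k) (D.C k) ab + view (h, k + 1, k) (D.R (k + 1)) ab ≠ 0) ⊆ P1 ∪ P2 ∪ P3 := by
    rintro ab hab
    obtain ⟨hab1, hab2⟩ := Finset.mem_filter.1 hab
    rw [Finset.mem_product] at hab1
    by_contra hno
    simp only [Finset.mem_union, not_or, P1, P2, P3, Finset.mem_filter, Finset.mem_univ, true_and,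
      Finset.mem_product, hab1, and_true, not_not] at hno
    obtain ⟨⟨h1, h2⟩, h3⟩ := hno
    apply hab2
    rw [← hD.1, D.total_eq (k + 1) k, hk, view_add, view_add, view_add] at h1
    simpa [h2, h3] using h1
  -- Each nonzero entry of R_k in column b lies in a nonzero row of R_k at the neighbour along b,
  -- which has at most μ of them.
  have hP2 : (P2.card : ℝ) ≤ Δ * μ := by
    have hP : P2.card ≤ ∑ b ∈ EBᶜ, rowNorm (view (colNbr (k + 1) (b : G) h, k, k) (D.R k)) := by
      have : P2.card = ∑ b ∈ EBᶜ, (Finset.univ.filter fun a : A =>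
          view (h, k + 1, k) (D.R k) (a, b) ≠ 0).card := by
        simp only [P2, Finset.card_filter]
        rw [Finset.sum_product_right]
      rw [this]
      refine Finset.sum_le_sum fun b _ => Finset.card_le_card fun a ha => ?_
      rw [Finset.mem_filter] at ha ⊢
      refine ⟨Finset.mem_univ _, b, ?_⟩
      have := ha.2
      simp only [view, hlabc] at this ⊢
      exact this
    calc (P2.card : ℝ) ≤ ∑ b ∈ EBᶜ,
          (rowNorm (view (colNbr (k + 1) (b : G) h, k, k) (D.R k)) : ℝ) := by exact_mod_cast hP
      _ ≤ ∑ b ∈ EBᶜ, μ := by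
        refine Finset.sum_le_sum fun b hb => ?_
        have := hμ k (colNbr (k + 1) (b : G) h) (by simpa [EB] using hb)
        linarith [Nat.cast_nonneg (α := ℝ) (colNorm (view (colNbr (k + 1) (b : G) h, k, k) (D.C k)))]
      _ ≤ Δ * μ := by
        rw [Finset.sum_const, nsmul_eq_mul]
        have : (EBᶜ).card ≤ Δ := by
          simpa [hB] using Finset.card_le_univ EBᶜ
        gcongr
  have hP3 : (P3.card : ℝ) ≤ Δ * μ := by
    have hP : P3.card ≤
        ∑ a ∈ EAᶜ, colNorm (view (rowNbr k (a : G) h, k + 1, k + 1) (D.C (k + 1))) := by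
      have : P3.card = ∑ a ∈ EAᶜ, (Finset.univ.filter fun b : B =>
          view (h, k + 1, k) (D.C (k + 1)) (a, b) ≠ 0).card := by
        simp only [P3, Finset.card_filter]
        rw [Finset.sum_product]
      rw [this]
      refine Finset.sum_le_sum fun a _ => Finset.card_le_card fun b hb => ?_
      rw [Finset.mem_filter] at hb ⊢
      refine ⟨Finset.mem_univ _, a, ?_⟩
      have := hb.2
      simp only [view, hlabr] at this ⊢
      exact this
    calc (P3.card : ℝ) ≤ ∑ a ∈ EAᶜ,
          (colNorm (view (rowNbr k (a : G) h, k + 1, k + 1) (D.C (k + 1))) : ℝ) := by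
          exact_mod_cast hP
      _ ≤ ∑ a ∈ EAᶜ, μ := by
        refine Finset.sum_le_sum fun a ha => ?_
        have := hμ (k + 1) (rowNbr k (a : G) h) (by simpa [EA] using ha)
        linarith [Nat.cast_nonneg (α := ℝ)
          (rowNorm (view (rowNbr k (a : G) h, k + 1, k + 1) (D.R (k + 1))))]
      _ ≤ Δ * μ := by
        rw [Finset.sum_const, nsmul_eq_mul]
        have : (EAᶜ).card ≤ Δ := by
          simpa [hA] using Finset.card_le_univ EAᶜ
        gcongr
  have hc := (Finset.card_le_card hsub).trans
    ((Finset.card_union_le _ _).trans (Nat.add_le_add_right (Finset.card_union_le _ _) _))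
  have hc' : ((((EAᶜ ×ˢ EBᶜ).filter fun ab => view (h, k + 1, k) (D.C k) ab +
      view (h, k + 1, k) (D.R (k + 1)) ab ≠ 0).card : ℕ) : ℝ) ≤ P1.card + P2.card + P3.card := by
    exact_mod_cast hc
  have hP1 : (P1.card : ℝ) = hammingNorm (view (h, k + 1, k) Z) := by
    norm_cast
  linarith

end ActiveVertices

/-! ### Numerical inequalities between δ, s = √Δ and e = Δ ^ ε. -/

/-- The regime of the parameters `δ`, `s = √Δ` and `e = Δ ^ ε`. -/
structure LargeParameters (δ s e : ℝ) : Prop where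
  δ_pos : 0 < δ
  δ_le_one : δ ≤ 1
  s_pos : 0 < s
  e_pos : 0 < e
  le_e : 2 ^ 22 ≤ δ ^ 3 * e
  le_s : 2 ^ 22 * e ^ 2 ≤ δ ^ 3 * s

namespace LargeParameters

variable {δ s e : ℝ}

theorem pow_le_pow (H : LargeParameters δ s e) {m n : ℕ} (h : m ≤ n) : δ ^ n ≤ δ ^ m :=
  pow_le_pow_of_le_one H.δ_pos.le H.δ_le_one h

theorem le_pow_mul_e (H : LargeParameters δ s e) {m : ℕ} (h : m ≤ 3) : 2 ^ 22 ≤ δ ^ m * e :=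
  H.le_e.trans (mul_le_mul_of_nonneg_right (H.pow_le_pow h) H.e_pos.le)

theorem le_pow_mul_s (H : LargeParameters δ s e) {m : ℕ} (h : m ≤ 3) :
    2 ^ 22 * e ^ 2 ≤ δ ^ m * s :=
  H.le_s.trans (mul_le_mul_of_nonneg_right (H.pow_le_pow h) H.s_pos.le)

theorem le_e₀ (H : LargeParameters δ s e) : 2 ^ 22 ≤ e := by
  simpa using H.le_pow_mul_e (Nat.zero_le 3)

theorem mul_e_le (H : LargeParameters δ s e) {m : ℕ} (h : m ≤ 3) : 2 ^ 44 * e ≤ δ ^ m * s := by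
  refine le_trans ?_ (H.le_pow_mul_s h)
  have := mul_le_mul_of_nonneg_right H.le_e₀ H.e_pos.le
  linarith

theorem e_le_s (H : LargeParameters δ s e) : 2 ^ 44 * e ≤ s := by
  simpa using H.mul_e_le (Nat.zero_le 3)

theorem le_pow_mul_s₀ (H : LargeParameters δ s e) {m : ℕ} (h : m ≤ 3) : 2 ^ 66 ≤ δ ^ m * s := by
  have := H.mul_e_le h
  have := H.le_e₀
  linarith

theorem le_s₀ (H : LargeParameters δ s e) : 2 ^ 66 ≤ s := by
  simpa using H.le_pow_mul_s₀ (Nat.zero_le 3)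

theorem threshold_le (H : LargeParameters δ s e) : δ * s ^ 3 / (16 * e) ≤ s ^ 3 / e := by
  have he := H.e_pos
  have hs := H.s_pos
  have h1 : δ / 16 ≤ 1 := by linarith [H.δ_le_one]
  calc δ * s ^ 3 / (16 * e) = δ / 16 * (s ^ 3 / e) := by field_simp
    _ ≤ 1 * (s ^ 3 / e) := by gcongr
    _ = _ := one_mul _

theorem div_e_le (H : LargeParameters δ s e) : s / e ≤ δ * s ^ 2 := by
  rw [div_le_iff₀ H.e_pos]
  have h1 := H.le_pow_mul_s₀ (m := 1) (by norm_num)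
  rw [pow_one] at h1
  have h2 := H.le_e₀
  have h3 : 1 ≤ δ * s * e := one_le_mul_of_one_le_of_one_le (by linarith) (by linarith)
  calc s = 1 * s := (one_mul s).symm
    _ ≤ δ * s * e * s := mul_le_mul_of_nonneg_right h3 H.s_pos.le
    _ = _ := by ring

theorem le_threshold (H : LargeParameters δ s e) :
    s ^ 2 * (δ / 4) ≤ δ * s ^ 3 / (16 * e) / 4 := by
  have he := H.e_pos
  have hδ := H.δ_pos
  rw [div_div, le_div_iff₀ (by positivity)]
  have h1 : 16 * e ≤ s := by linarith [H.e_le_s]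
  have h2 : 0 ≤ δ * s ^ 2 := by positivity
  calc s ^ 2 * (δ / 4) * (16 * e * 4) = δ * s ^ 2 * (16 * e) := by ring
    _ ≤ δ * s ^ 2 * s := mul_le_mul_of_nonneg_left h1 h2
    _ = _ := by ring

theorem le_half_density (H : LargeParameters δ s e) : δ / 4 ≤ δ * s ^ 2 / 4 / 2 := by
  have h1 : 2 ≤ s ^ 2 := by nlinarith [H.le_s₀]
  have := mul_le_mul_of_nonneg_left h1 H.δ_pos.le
  linarith

theorem density_le (H : LargeParameters δ s e) :
    2 * (s / (8 * e) + δ * s ^ 2 / 4) ≤ δ * s ^ 2 := by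
  have h1 := H.div_e_le
  have h2 : s / (8 * e) = s / e / 8 := by rw [mul_comm, div_div]
  rw [h2]
  linarith [mul_pos H.δ_pos (pow_pos H.s_pos 2)]

theorem exceptional_le (H : LargeParameters δ s e) {σ : ℝ} (hσ : 0 ≤ σ) :
    65536 * e ^ 2 * σ / (δ ^ 2 * s ^ 2) ≤ σ / 16 := by
  have hδ := H.δ_pos
  have hs := H.s_pos
  have he := H.e_pos
  have h1 : 2 ^ 20 * e ^ 2 ≤ δ ^ 2 * s ^ 2 := by
    have h2 := H.mul_e_le (m := 1) (by norm_num)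
    have h3 : (2 ^ 44 * e) ^ 2 ≤ (δ ^ 1 * s) ^ 2 := pow_le_pow_left₀ (by positivity) h2 2
    have h4 : 0 ≤ e ^ 2 := by positivity
    rw [mul_pow, mul_pow, pow_one] at h3
    linarith
  rw [div_le_div_iff₀ (by positivity) (by norm_num)]
  calc 65536 * e ^ 2 * σ * 16 = σ * (2 ^ 20 * e ^ 2) := by ring
    _ ≤ _ := mul_le_mul_of_nonneg_left h1 hσ

/-- The left side is the weighted exceptional degree in the averaging. Its second term has order e²
/ s, which is why s must dominate e². -/
theorem sum_exceptional_le (H : LargeParameters δ s e) {σ : ℝ} (hσ : 0 ≤ σ) :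
    2 * e * ((256 / (δ * s ^ 2) + 32768 * e / (δ ^ 2 * s)) * σ) ≤ σ / 16 := by
  have hδ := H.δ_pos
  have hs := H.s_pos
  have he := H.e_pos
  have h4 : 256 * (2 * e) / (δ * s ^ 2) ≤ 1 / 32 := by
    rw [div_le_div_iff₀ (by positivity) (by norm_num)]
    have h1 := H.mul_e_le (m := 1) (by norm_num)
    rw [pow_one] at h1
    have h2 : δ * s * 1 ≤ δ * s * s :=
      mul_le_mul_of_nonneg_left (by linarith [H.le_s₀]) (by positivity)
    have h3 : δ * s * s = δ * s ^ 2 := by ring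
    linarith
  have h5 : 32768 * e * (2 * e) / (δ ^ 2 * s) ≤ 1 / 32 := by
    rw [div_le_div_iff₀ (by positivity) (by norm_num)]
    have h1 := H.le_pow_mul_s (m := 2) (by norm_num)
    linarith [sq_nonneg e]
  calc _ = (256 * (2 * e) / (δ * s ^ 2) + 32768 * e * (2 * e) / (δ ^ 2 * s)) * σ := by ring
    _ ≤ (1 / 32 + 1 / 32) * σ := by gcongr
    _ = _ := by ring

theorem mixing_bound_le (H : LargeParameters δ s e) {σ n : ℝ} (hσ0 : 0 ≤ σ) (hn : 0 < n)
    (hσn : s ^ 2 * σ / n ≤ δ / 4) :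
    2 * (s ^ 2 * (65536 * e ^ 2 * σ / (δ ^ 2 * s ^ 2)) * (512 * σ / (δ ^ 2 * s ^ 2)) / n +
      2 * s * Real.sqrt (65536 * e ^ 2 * σ / (δ ^ 2 * s ^ 2) * (512 * σ / (δ ^ 2 * s ^ 2)))) ≤
    (256 / (δ * s ^ 2) + 32768 * e / (δ ^ 2 * s)) * σ := by
  have hδ := H.δ_pos
  have hs := H.s_pos
  have he := H.e_pos
  have h1 : Real.sqrt (65536 * e ^ 2 * σ / (δ ^ 2 * s ^ 2) * (512 * σ / (δ ^ 2 * s ^ 2))) ≤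
      8192 * e * σ / (δ ^ 2 * s ^ 2) := by
    refine Real.sqrt_le_iff.2 ⟨by positivity, ?_⟩
    have : 0 ≤ e ^ 2 * σ ^ 2 / (δ ^ 2 * s ^ 2) ^ 2 := by positivity
    -- 65536 · 512 = 2²⁵ is rounded up to 2²⁶ = 8192² to have an exact square root.
    calc _ = 33554432 * (e ^ 2 * σ ^ 2 / (δ ^ 2 * s ^ 2) ^ 2) := by ring
      _ ≤ 67108864 * (e ^ 2 * σ ^ 2 / (δ ^ 2 * s ^ 2) ^ 2) := by linarith
      _ = _ := by ring
  have h2 : 65536 * e ^ 2 * σ / (δ ^ 2 * s ^ 2) ≤ σ := by linarith [H.exceptional_le hσ0]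
  have h3 : s ^ 2 * (65536 * e ^ 2 * σ / (δ ^ 2 * s ^ 2)) * (512 * σ / (δ ^ 2 * s ^ 2)) / n ≤
      δ / 4 * (512 * σ / (δ ^ 2 * s ^ 2)) := by
    calc _ ≤ s ^ 2 * σ * (512 * σ / (δ ^ 2 * s ^ 2)) / n := by gcongr
      _ = s ^ 2 * σ / n * (512 * σ / (δ ^ 2 * s ^ 2)) := by ring
      _ ≤ _ := mul_le_mul_of_nonneg_right hσn (by positivity)
  calc _ ≤ 2 * (δ / 4 * (512 * σ / (δ ^ 2 * s ^ 2)) +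
        2 * s * (8192 * e * σ / (δ ^ 2 * s ^ 2))) := by gcongr
    _ = _ := by field_simp; ring

theorem puncture_le (H : LargeParameters δ s e) {c : ℝ} {m : ℕ} (hm : m ≤ 3) (hc : 0 < c)
    (hc' : c ≤ 2 ^ 22) : s ^ 2 / e ≤ δ ^ m * s ^ 2 / c := by
  rw [div_le_div_iff₀ H.e_pos hc]
  have h1 : c ≤ δ ^ m * e := hc'.trans (H.le_pow_mul_e hm)
  calc s ^ 2 * c ≤ s ^ 2 * (δ ^ m * e) := mul_le_mul_of_nonneg_left h1 (sq_nonneg s)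
    _ = _ := by ring

/-- The left side bounds the columns and rows at a V_1 vertex after puncturing; the right side is
the threshold α of the averaging. The term of order s / (e δ) requires the third power of δ. -/
theorem norm_bound_le (H : LargeParameters δ s e) :
    2 * (s ^ 2 / e + s ^ 3 / e / (δ * s ^ 2 - s ^ 2 / e)) ≤ δ ^ 2 * s ^ 2 / 8192 := by
  have hδ := H.δ_pos
  have hs := H.s_pos
  have he := H.e_pos
  have hpd := H.puncture_le (m := 1) (c := 2) (by norm_num) (by norm_num) (by norm_num)
  rw [pow_one] at hpd
  have hw : s ^ 3 / e / (δ * s ^ 2 - s ^ 2 / e) ≤ 2 * s / (e * δ) := by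
    calc s ^ 3 / e / (δ * s ^ 2 - s ^ 2 / e) ≤ s ^ 3 / e / (δ * s ^ 2 / 2) := by
          gcongr; linarith
      _ = _ := by field_simp
  have h1 := H.puncture_le (m := 2) (c := 32768) (by norm_num) (by norm_num) (by norm_num)
  have h2 : 2 * s / (e * δ) ≤ δ ^ 2 * s ^ 2 / 32768 := by
    rw [div_le_div_iff₀ (by positivity) (by norm_num)]
    have h3 : 1 ≤ s := by linarith [H.le_s₀]
    have h4 : 65536 ≤ δ ^ 3 * e * s := by
      calc (65536 : ℝ) ≤ 2 ^ 22 * 1 := by norm_num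
        _ ≤ δ ^ 3 * e * s := mul_le_mul H.le_e h3 (by norm_num) (by positivity)
    calc 2 * s * 32768 = s * 65536 := by ring
      _ ≤ s * (δ ^ 3 * e * s) := mul_le_mul_of_nonneg_left h4 hs.le
      _ = _ := by ring
  linarith

end LargeParameters

/-! ### Charging active vertices to V_1 and averaging. -/

section Counting

variable {G : Type*} [Group G] [Fintype G] {A B : Finset G} {Δ : ℕ}
  {CA : Submodule (ZMod 2) (A → ZMod 2)} {CB : Submodule (ZMod 2) (B → ZMod 2)}

open Classical in
/-- The number of nonzero columns and rows at `(h, k + 1, k)` attached to nonexceptional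
vertices. -/
noncomputable def Decomposition.regularDegree (D : Decomposition CA CB) (τ : ℝ) (k : Fin 2)
    (h : G) : ℕ :=
  (Finset.univ.filter fun b : B => (∃ a, view (h, k + 1, k) (D.C k) (a, b) ≠ 0) ∧
    colNbr (k + 1) (b : G) h ∉ D.exceptionalAt τ k).card +
  (Finset.univ.filter fun a : A => (∃ b, view (h, k + 1, k) (D.R (k + 1)) (a, b) ≠ 0) ∧
    rowNbr k (a : G) h ∉ D.exceptionalAt τ (k + 1)).card

open Classical in
/-- The number of exceptional neighbours of `(h, k + 1, k)`. -/
noncomputable def Decomposition.exceptionalDegree (D : Decomposition CA CB) (τ : ℝ) (k : Fin 2)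
    (h : G) : ℕ :=
  (Finset.univ.filter fun a : A => rowNbr k (a : G) h ∈ D.exceptionalAt τ (k + 1)).card +
  (Finset.univ.filter fun b : B => colNbr (k + 1) (b : G) h ∈ D.exceptionalAt τ k).card

theorem Decomposition.regularDegree_le (D : Decomposition CA CB) (τ : ℝ) (k : Fin 2) (h : G) :
    D.regularDegree τ k h ≤
      colNorm (view (h, k + 1, k) (D.C k)) + rowNorm (view (h, k + 1, k) (D.R (k + 1))) := by
  classical
  refine Nat.add_le_add (Finset.card_le_card fun x hx => ?_) (Finset.card_le_card fun x hx => ?_)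
  all_goals
    rw [Finset.mem_filter] at hx ⊢
    exact ⟨Finset.mem_univ _, hx.2.1⟩

theorem Decomposition.regularDegree_le_two_mul (D : Decomposition CA CB) (hA : A.card = Δ)
    (hB : B.card = Δ) (τ : ℝ) (k : Fin 2) (h : G) : D.regularDegree τ k h ≤ 2 * Δ := by
  classical
  have h1 := Finset.card_le_univ (Finset.univ.filter fun b : B =>
    (∃ a, view (h, k + 1, k) (D.C k) (a, b) ≠ 0) ∧
    colNbr (k + 1) (b : G) h ∉ D.exceptionalAt τ k)
  have h2 := Finset.card_le_univ (Finset.univ.filter fun a : A =>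
    (∃ b, view (h, k + 1, k) (D.R (k + 1)) (a, b) ≠ 0) ∧
    rowNbr k (a : G) h ∉ D.exceptionalAt τ (k + 1))
  rw [Fintype.card_coe, hB] at h1
  rw [Fintype.card_coe, hA] at h2
  unfold Decomposition.regularDegree
  convert! (add_le_add h1 h2).trans (two_mul Δ).ge

-- An active vertex outside E has a nonzero column of C_k or a nonzero row of R_k, which pays for
-- it.
open Classical in
theorem Decomposition.card_activeAt_le (D : Decomposition CA CB) (E : Finset G) (k : Fin 2) :
    (D.activeAt k).card ≤
      (∑ g, (Finset.univ.filter fun b : B =>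
        (∃ a, view (g, k, k) (D.C k) (a, b) ≠ 0) ∧ g ∉ E).card) +
      (∑ g, (Finset.univ.filter fun a : A =>
        (∃ b, view (g, k, k) (D.R k) (a, b) ≠ 0) ∧ g ∉ E).card) + E.card := by
  rw [← Finset.sum_add_distrib]
  refine (Finset.le_card_sdiff E (D.activeAt k) |> Nat.sub_le_iff_le_add.1).trans
    (Nat.add_le_add_right ?_ _)
  rw [Finset.card_eq_sum_ones]
  refine (Finset.sum_le_sum fun g hg => ?_).trans
    (Finset.sum_le_sum_of_subset (Finset.subset_univ _))
  rw [Finset.mem_sdiff, Decomposition.activeAt, Finset.mem_filter] at hg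
  obtain ⟨⟨-, hne⟩, hE⟩ := hg
  obtain ⟨⟨a, b⟩, hab⟩ := Function.ne_iff.1 hne
  by_cases hc : view (g, k, k) (D.C k) (a, b) = 0
  · refine le_add_left (Finset.card_pos.2 ⟨a, Finset.mem_filter.2 ⟨Finset.mem_univ _, ⟨b, ?_⟩, hE⟩⟩)
    rwa [view_add, Pi.add_apply, hc, zero_add] at hab
  · exact le_add_right
      (Finset.card_pos.2 ⟨b, Finset.mem_filter.2 ⟨Finset.mem_univ _, ⟨a, hc⟩, hE⟩⟩)

-- The vertex `(h, k + 1, k)` collects columns of C_k from V_{kk} and rows of R_{k+1} from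
-- V_{k+1,k+1}. Over both values of k, every charge from V_0 is collected once.
open Classical in
theorem Decomposition.sum_card_activeAt_le (D : Decomposition CA CB) (τ : ℝ) :
    ∑ k, (D.activeAt k).card ≤
      ∑ k, ∑ h, D.regularDegree τ k h + ∑ k, (D.exceptionalAt τ k).card := by
  have h1 : ∀ k, ∑ h, D.regularDegree τ k h =
      (∑ g, (Finset.univ.filter fun b : B =>
        (∃ a, view (g, k, k) (D.C k) (a, b) ≠ 0) ∧ g ∉ D.exceptionalAt τ k).card) +
      ∑ g, (Finset.univ.filter fun a : A => (∃ b, view (g, k + 1, k + 1) (D.R (k + 1)) (a, b) ≠ 0) ∧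
        g ∉ D.exceptionalAt τ (k + 1)).card := by
    intro k
    have hk : k + 1 + 1 = k := by fin_cases k <;> rfl
    have hc := sum_card_columns (D.C k) k k fun g => g ∉ D.exceptionalAt τ k
    have hr := sum_card_rows (D.R (k + 1)) (k + 1) (k + 1) fun g => g ∉ D.exceptionalAt τ (k + 1)
    rw [hk] at hr
    simp only [Decomposition.regularDegree, Finset.sum_add_distrib]
    congr 1
    · convert! hc
    · convert! hr
  have h2 := D.card_activeAt_le (D.exceptionalAt τ 0) 0
  have h3 := D.card_activeAt_le (D.exceptionalAt τ 1) 1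
  have h4 := h1 0
  have h5 := h1 1
  rw [show (0 : Fin 2) + 1 = 1 from rfl] at h4
  rw [show (1 : Fin 2) + 1 = 0 from rfl] at h5
  rw [Fin.sum_univ_two, Fin.sum_univ_two, Fin.sum_univ_two, h4, h5]
  linarith

open Classical in
/-- The vertices `(h, k + 1, k)` with many active neighbours across rows or across columns. -/
noncomputable def Decomposition.dense (D : Decomposition CA CB) (θ : ℝ) (k : Fin 2) : Finset G :=
  (Finset.univ.filter fun h => θ ≤
      (Finset.univ.filter fun a : A => rowNbr k (a : G) h ∈ D.activeAt (k + 1)).card) ∪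
    Finset.univ.filter fun h => θ ≤
      (Finset.univ.filter fun b : B => colNbr (k + 1) (b : G) h ∈ D.activeAt k).card

/-- Mixing bounds the row part and the column part by 16 Δ σ / θ² each. -/
theorem Decomposition.card_dense_le (D : Decomposition CA CB) (hG : GoodGenerators A B Δ)
    (hΔ : 1 ≤ Δ) {θ σ : ℝ} (hθ : 0 < θ) (hσ : ∀ k, ((D.activeAt k).card : ℝ) ≤ σ)
    (hn : Δ * σ / Fintype.card G ≤ θ / 2) (k : Fin 2) :
    ((D.dense θ k).card : ℝ) ≤ 32 * Δ * σ / θ ^ 2 := by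
  classical
  have key : ∀ (T S : Finset G) (c : G → ℝ), (S.card : ℝ) ≤ σ → (∀ h ∈ T, θ ≤ c h) →
      (∑ h ∈ T, c h ≤ Δ * S.card * T.card / Fintype.card G +
        2 * Real.sqrt Δ * Real.sqrt (S.card * T.card)) → (T.card : ℝ) ≤ 16 * Δ * σ / θ ^ 2 := by
    intro T S c hS hc hmix
    have h1 := card_le_of_mixing hθ (Nat.cast_nonneg _) hc hmix (le_trans (by gcongr) hn)
    refine h1.trans ?_
    rw [mul_pow, Real.sq_sqrt (Nat.cast_nonneg _)]
    calc 4 * (2 ^ 2 * (Δ : ℝ)) * S.card / θ ^ 2 ≤ 4 * (2 ^ 2 * (Δ : ℝ)) * σ / θ ^ 2 := by gcongr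
      _ = _ := by ring
  have h1 := key (Finset.univ.filter fun h => θ ≤
      (Finset.univ.filter fun a : A => rowNbr k (a : G) h ∈ D.activeAt (k + 1)).card)
    (D.activeAt (k + 1)) _ (hσ _)
    (fun h hh => (Finset.mem_filter.1 hh).2) (sum_card_rowNbr_le hG hΔ _ _ _)
  have h2 := key (Finset.univ.filter fun h => θ ≤
      (Finset.univ.filter fun b : B => colNbr (k + 1) (b : G) h ∈ D.activeAt k).card)
    (D.activeAt k) _ (hσ _)
    (fun h hh => (Finset.mem_filter.1 hh).2) (sum_card_colNbr_le hG hΔ _ _ _)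
  have h3 : (D.dense θ k).card ≤ _ + _ := Finset.card_union_le _ _
  have h4 := Nat.cast_le (α := ℝ).2 h3
  rw [Nat.cast_add] at h4
  refine (h4.trans (add_le_add h1 h2)).trans (le_of_eq ?_)
  ring

/-- By stalling, a view of weight more than τ has at least τ / 2 active opposite corners; mixing for
the two-step walk does the rest. -/
theorem Decomposition.card_exceptionalAt_le {D : Decomposition CA CB} {Z : Square A B → ZMod 2}
    (hG : GoodGenerators A B Δ) (hΔ : 1 ≤ Δ) (hD : D.total = Z) (hZ : IsStalled CA CB Z)
    {τ σ : ℝ} (hτ : 0 < τ) (hσ : ∀ k, ((D.activeAt k).card : ℝ) ≤ σ)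
    (hn : (Δ : ℝ) ^ 2 * σ / Fintype.card G ≤ τ / 4) (k : Fin 2) :
    ((D.exceptionalAt τ k).card : ℝ) ≤ 256 * (Δ : ℝ) ^ 2 * σ / τ ^ 2 := by
  classical
  have h1 := card_le_of_mixing (T := D.exceptionalAt τ k) (θ := τ / 2) (by positivity)
    (Nat.cast_nonneg _) (c := fun g => ((Finset.univ.filter fun ab : A × B =>
      rowNbr k (ab.1 : G) (colNbr k (ab.2 : G) g) ∈ D.activeAt (k + 1)).card : ℝ)) (by
      intro g hg
      have h1 := (Finset.mem_filter.1 hg).2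
      have h2 : (hammingNorm (view (g, k, k) (D.C k + D.R k)) : ℝ) ≤
          2 * (Finset.univ.filter fun ab : A × B =>
          rowNbr k (ab.1 : G) (colNbr k (ab.2 : G) g) ∈ D.activeAt (k + 1)).card := by
        exact_mod_cast D.hammingNorm_view_le hD hZ k g
      linarith)
    (sum_card_rowNbr_colNbr_le hG hΔ k k (D.activeAt (k + 1)) _)
    (le_trans (by gcongr; exact hσ _) (hn.trans (by linarith)))
  refine h1.trans ?_
  calc _ ≤ 4 * (4 * (Δ : ℝ)) ^ 2 * σ / (τ / 2) ^ 2 := by gcongr; exact hσ _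
    _ = _ := by ring

theorem Decomposition.sum_exceptionalDegree_le (D : Decomposition CA CB)
    (hG : GoodGenerators A B Δ) (hΔ : 1 ≤ Δ) (τ : ℝ) (k : Fin 2) (T : Finset G) {η ν : ℝ}
    (hE : ∀ k, ((D.exceptionalAt τ k).card : ℝ) ≤ η) (hT : (T.card : ℝ) ≤ ν) :
    ∑ h ∈ T, (D.exceptionalDegree τ k h : ℝ) ≤
      2 * (Δ * η * ν / Fintype.card G + 2 * Real.sqrt Δ * Real.sqrt (η * ν)) := by
  classical
  have hη : 0 ≤ η := le_trans (Nat.cast_nonneg _) (hE k)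
  have hb : ∀ k, (Δ : ℝ) * (D.exceptionalAt τ k).card * T.card / Fintype.card G +
      2 * Real.sqrt Δ * Real.sqrt ((D.exceptionalAt τ k).card * T.card) ≤
      Δ * η * ν / Fintype.card G + 2 * Real.sqrt Δ * Real.sqrt (η * ν) := by
    intro k
    have := hE k
    gcongr
  have h1 := (sum_card_rowNbr_le hG hΔ k (D.exceptionalAt τ (k + 1)) T).trans (hb _)
  have h2 := (sum_card_colNbr_le hG hΔ (k + 1) (D.exceptionalAt τ k) T).trans (hb _)
  have h3 := add_le_add h1 h2
  rw [← Finset.sum_add_distrib] at h3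
  rw [two_mul]
  refine le_trans (le_of_eq ?_) h3
  refine Finset.sum_congr rfl fun h _ => ?_
  rw [Decomposition.exceptionalDegree]
  push_cast
  rfl

/-- A vertex of `V_1` with a nonzero column or row attached to a nonexceptional vertex has many
active neighbours. -/
theorem Decomposition.mem_dense {D : Decomposition CA CB} {Z : Square A B → ZMod 2}
    (hD : D.total = Z) (hZ : IsStalled CA CB Z) {τ μ d θ : ℝ} (hdA : d ≤ minDist CA)
    (hdB : d ≤ minDist CB) (hμ : ∀ k g, g ∉ D.exceptionalAt τ k →
      (colNorm (view (g, k, k) (D.C k)) : ℝ) + rowNorm (view (g, k, k) (D.R k)) ≤ μ)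
    (hθ : 2 * (μ + θ) ≤ d) {k : Fin 2} {h : G} (hh : D.regularDegree τ k h ≠ 0) :
    h ∈ D.dense θ k := by
  classical
  rw [Decomposition.dense, Finset.mem_union, Finset.mem_filter, Finset.mem_filter]
  rw [Decomposition.regularDegree, ne_eq, Nat.add_eq_zero_iff, not_and_or] at hh
  rcases hh with hh | hh
  · obtain ⟨b, hb⟩ := Finset.card_ne_zero.1 hh
    obtain ⟨-, hb1, hb2⟩ := Finset.mem_filter.1 hb
    have h1 := hμ k _ hb2
    have h2 := D.le_card_of_column hD hZ k h b hb1
    have h3 : (minDist CA : ℝ) ≤ 2 * (rowNorm (view (colNbr (k + 1) (b : G) h, k, k) (D.R k)) +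
      (Finset.univ.filter fun a : A => rowNbr k (a : G) h ∈ D.activeAt (k + 1)).card) := by
      exact_mod_cast h2
    have h4 : (0 : ℝ) ≤ colNorm (view (colNbr (k + 1) (b : G) h, k, k) (D.C k)) :=
      Nat.cast_nonneg _
    exact Or.inl ⟨Finset.mem_univ _, by linarith⟩
  · obtain ⟨a, ha⟩ := Finset.card_ne_zero.1 hh
    obtain ⟨-, ha1, ha2⟩ := Finset.mem_filter.1 ha
    have h1 := hμ (k + 1) _ ha2
    have h2 := D.le_card_of_row hD hZ k h a ha1
    have h3 : (minDist CB : ℝ) ≤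
      2 * (colNorm (view (rowNbr k (a : G) h, k + 1, k + 1) (D.C (k + 1))) +
      (Finset.univ.filter fun b : B => colNbr (k + 1) (b : G) h ∈ D.activeAt k).card) := by
      exact_mod_cast h2
    have h4 : (0 : ℝ) ≤ rowNorm (view (rowNbr k (a : G) h, k + 1, k + 1) (D.R (k + 1))) :=
      Nat.cast_nonneg _
    exact Or.inr ⟨Finset.mem_univ _, by linarith⟩

/-- The averaging argument: some dense vertex has large regular degree compared with its
exceptional degree and its number of mismatched squares. -/
theorem Decomposition.exists_lt_regularDegree (D : Decomposition CA CB) (Z : Square A B → ZMod 2)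
    {τ : ℝ} {T : Fin 2 → Finset G} (hT : ∀ k h, D.regularDegree τ k h ≠ 0 → h ∈ T k)
    {α β γ η ν ξ : ℝ} (hα : 0 ≤ α) (hβ : 0 ≤ β) (hγ : 0 ≤ γ)
    (hE : ∀ k, ((D.exceptionalAt τ k).card : ℝ) ≤ η) (hν : ∀ k, ((T k).card : ℝ) ≤ ν)
    (hξ : ∀ k, ∑ h ∈ T k, (D.exceptionalDegree τ k h : ℝ) ≤ ξ)
    (hlt : 2 * (η + α * ν + β * ξ + γ * hammingNorm Z) < ((∑ k, (D.activeAt k).card : ℕ) : ℝ)) :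
    ∃ k h, α + β * D.exceptionalDegree τ k h + γ * hammingNorm (view (h, k + 1, k) Z) <
      D.regularDegree τ k h := by
  by_contra! hno
  have h1 : ((∑ k, (D.activeAt k).card : ℕ) : ℝ) ≤
      ∑ k, ∑ h, (D.regularDegree τ k h : ℝ) + ∑ k, ((D.exceptionalAt τ k).card : ℝ) := by
    exact_mod_cast D.sum_card_activeAt_le τ
  have h2 : ∀ k, ∑ h, (D.regularDegree τ k h : ℝ) ≤ α * ν + β * ξ + γ * hammingNorm Z := by
    intro k
    have h3 : ∑ h, (D.regularDegree τ k h : ℝ) = ∑ h ∈ T k, (D.regularDegree τ k h : ℝ) := by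
      refine (Finset.sum_subset (Finset.subset_univ _) fun h _ hh => ?_).symm
      by_contra h0
      exact hh (hT k h (by exact_mod_cast h0))
    rw [h3]
    refine (Finset.sum_le_sum fun h _ => hno k h).trans ?_
    rw [Finset.sum_add_distrib, Finset.sum_add_distrib, ← Finset.mul_sum, ← Finset.mul_sum,
      Finset.sum_const, nsmul_eq_mul]
    have h4 : ∑ h ∈ T k, (hammingNorm (view (h, k + 1, k) Z) : ℝ) ≤ hammingNorm Z := by
      rw [← sum_hammingNorm_view Z (k + 1) k]
      push_cast
      exact Finset.sum_le_sum_of_subset_of_nonneg (Finset.subset_univ _)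
        fun _ _ _ => Nat.cast_nonneg _
    have h5 : ((T k).card : ℝ) * α ≤ α * ν := by
      rw [mul_comm]; exact mul_le_mul_of_nonneg_left (hν k) hα
    have h6 := mul_le_mul_of_nonneg_left (hξ k) hβ
    have h7 := mul_le_mul_of_nonneg_left h4 hγ
    linarith
  have h3 := h2 0
  have h4 := h2 1
  have h5 := hE 0
  have h6 := hE 1
  push_cast at h1 hlt
  simp only [Fin.sum_univ_two] at h1 hlt
  linarith

/-- The lower bound on the weight of the mismatch, in terms of `s = √Δ` and `e = Δ ^ ε`. -/
theorem Decomposition.IsMinimal.card_le_of_stalled {D : Decomposition CA CB}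
    {Z : Square A B → ZMod 2} (hG : GoodGenerators A B Δ) (hD : D.IsMinimal Z)
    (hZ : IsStalled CA CB Z) {δ s e : ℝ} (H : LargeParameters δ s e)
    (hΔs : (Δ : ℝ) = s ^ 2) (hrob : IsRobustResistant CA CB (s ^ 3 / e) (s ^ 2 / e))
    (hdA : δ * Δ ≤ minDist CA) (hdB : δ * Δ ≤ minDist CB)
    (hact : (D.active.card : ℝ) ≤ δ / (8 * Δ) * (V0 G).card) :
    1 / 64 * (D.active.card : ℝ) * (s / e) ≤ hammingNorm Z := by
  by_contra! hlt
  have hδ := H.δ_pos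
  have hs := H.s_pos
  have he := H.e_pos
  set σ : ℝ := (D.active.card : ℝ) with hσ
  have hσ0 : 0 ≤ σ := Nat.cast_nonneg _
  have hσpos : 0 < σ := by
    refine hσ0.lt_of_ne' fun h0 => ?_
    rw [h0, mul_zero, zero_mul] at hlt
    exact absurd hlt (not_lt.2 (Nat.cast_nonneg _))
  have hn : (0 : ℝ) < Fintype.card G := by exact_mod_cast Fintype.card_pos
  have hΔ : 1 ≤ Δ := by
    have : (1 : ℝ) ≤ Δ := by rw [hΔs]; exact one_le_pow₀ (by linarith [H.le_s₀])
    exact_mod_cast this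
  have hsum : (∑ k, (D.activeAt k).card : ℕ) = D.active.card := by
    rw [Fin.sum_univ_two, D.card_active]
  have hσk : ∀ k, ((D.activeAt k).card : ℝ) ≤ σ := by
    intro k
    rw [hσ, ← hsum]
    exact_mod_cast Finset.single_le_sum (f := fun k => (D.activeAt k).card)
      (fun _ _ => Nat.zero_le _) (Finset.mem_univ k)
  -- The density hypothesis, with |V_0| = 2 |G|; it makes the main terms of the mixing bounds
  -- absorbable.
  have hσn : s ^ 2 * σ / Fintype.card G ≤ δ / 4 := by
    rw [card_V0, hΔs] at hact
    rw [div_le_iff₀ hn]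
    have : δ / (8 * s ^ 2) * ((2 * Fintype.card G : ℕ) : ℝ) =
        δ / 4 * Fintype.card G / s ^ 2 := by
      push_cast
      field_simp
      ring
    rw [this, le_div_iff₀ (by positivity)] at hact
    linarith
  -- The factor δ / 16 makes the bound 2 τ / d at nonexceptional vertices equal to s / (8 e), so
  -- that R_k and C_{k+1} together contribute at most s³ / (4 e) to a punctured V_1 view.
  set τ : ℝ := δ * s ^ 3 / (16 * e) with hτ
  have hτ0 : 0 < τ := by positivity
  have hτd : τ / (δ * Δ) = s / e / 16 := by
    rw [hτ, hΔs]; field_simp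
  have hμ : ∀ k g, g ∉ D.exceptionalAt τ k → (colNorm (view (g, k, k) (D.C k)) : ℝ) +
      rowNorm (view (g, k, k) (D.R k)) ≤ s / (8 * e) := by
    intro k g hg
    have hlt' : τ / (δ * Δ) < δ * Δ := by
      have h1 : 0 < s / e := by positivity
      rw [hτd, hΔs]
      linarith [H.div_e_le]
    refine (hD.norm_le_of_notMem hrob hdA hdB (hG.card_A.trans hG.card_B.symm) (by positivity)
      (by rw [hΔs]; positivity) H.threshold_le hlt' hg).trans (le_of_eq ?_)
    rw [hτd]; field_simp; norm_num
  have hE : ∀ k, ((D.exceptionalAt τ k).card : ℝ) ≤ 65536 * e ^ 2 * σ / (δ ^ 2 * s ^ 2) := by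
    intro k
    refine (D.card_exceptionalAt_le hG hΔ hD.1 hZ hτ0 hσk ?_ k).trans (le_of_eq ?_)
    · rw [hΔs]
      calc (s ^ 2) ^ 2 * σ / Fintype.card G = s ^ 2 * (s ^ 2 * σ / Fintype.card G) := by ring
        _ ≤ s ^ 2 * (δ / 4) := mul_le_mul_of_nonneg_left hσn (sq_nonneg s)
        _ ≤ τ / 4 := H.le_threshold
    · rw [hτ, hΔs]; field_simp; norm_num
  have hT : ∀ k, ((D.dense (δ * s ^ 2 / 4) k).card : ℝ) ≤ 512 * σ / (δ ^ 2 * s ^ 2) := by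
    intro k
    refine (D.card_dense_le hG hΔ (by positivity) hσk ?_ k).trans (le_of_eq ?_)
    · rw [hΔs]
      exact hσn.trans H.le_half_density
    · rw [hΔs]; field_simp; norm_num
  have hmem : ∀ k h, D.regularDegree τ k h ≠ 0 → h ∈ D.dense (δ * s ^ 2 / 4) k := by
    intro k h hh
    refine D.mem_dense hD.1 hZ hdA hdB hμ ?_ hh
    rw [hΔs]
    exact H.density_le
  have hEσ := H.exceptional_le hσ0
  have hξ : ∀ k, ∑ h ∈ D.dense (δ * s ^ 2 / 4) k, (D.exceptionalDegree τ k h : ℝ) ≤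
      (256 / (δ * s ^ 2) + 32768 * e / (δ ^ 2 * s)) * σ := by
    intro k
    refine (D.sum_exceptionalDegree_le hG hΔ τ k _ hE (hT k)).trans ?_
    rw [show Real.sqrt Δ = s by rw [hΔs, Real.sqrt_sq hs.le], hΔs]
    exact H.mixing_bound_le hσ0 hn hσn
  -- Each of the four terms is at most σ / 16, so the left side is at most σ / 2.
  have htotal : 2 * (65536 * e ^ 2 * σ / (δ ^ 2 * s ^ 2) +
      δ ^ 2 * s ^ 2 / 8192 * (512 * σ / (δ ^ 2 * s ^ 2)) +
      2 * e * ((256 / (δ * s ^ 2) + 32768 * e / (δ ^ 2 * s)) * σ) +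
      4 * e / s * hammingNorm Z) < ((∑ k, (D.activeAt k).card : ℕ) : ℝ) := by
    rw [hsum, ← hσ]
    have h2 : δ ^ 2 * s ^ 2 / 8192 * (512 * σ / (δ ^ 2 * s ^ 2)) = σ / 16 := by
      field_simp; norm_num
    have h6 : 4 * e / s * (hammingNorm Z : ℝ) ≤ σ / 16 := by
      calc _ ≤ 4 * e / s * (1 / 64 * σ * (s / e)) :=
            mul_le_mul_of_nonneg_left hlt.le (by positivity)
        _ = _ := by field_simp; norm_num
    linarith [H.sum_exceptional_le hσ0]
  -- Since the regular degree is at most 2 s², β = 2 e forces at most s² / e exceptional neighbours,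
  -- the puncturing allowance, and γ = 4 e / s forces a local mismatch of at most half the
  -- robustness range. α is the bound contradicted at the end.
  obtain ⟨k, h, hkh⟩ := D.exists_lt_regularDegree Z hmem (α := δ ^ 2 * s ^ 2 / 8192)
    (β := 2 * e) (γ := 4 * e / s) (by positivity) (by positivity)
    (by positivity) hE hT hξ htotal
  have hdeg : (D.regularDegree τ k h : ℝ) ≤ 2 * s ^ 2 := by
    rw [← hΔs]
    exact_mod_cast D.regularDegree_le_two_mul hG.card_A hG.card_B τ k h
  have hα0 : 0 ≤ δ ^ 2 * s ^ 2 / 8192 := by positivity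
  have hβ0 : 0 ≤ 2 * e * (D.exceptionalDegree τ k h : ℝ) := by positivity
  have hγ0 : 0 ≤ 4 * e / s * (hammingNorm (view (h, k + 1, k) Z) : ℝ) := by positivity
  have hex : (D.exceptionalDegree τ k h : ℝ) ≤ s ^ 2 / e := by
    rw [le_div_iff₀ he]; linarith
  have hz : (hammingNorm (view (h, k + 1, k) Z) : ℝ) ≤ s ^ 3 / e / 2 := by
    have h1 : 4 * e / s * (hammingNorm (view (h, k + 1, k) Z) : ℝ) ≤ 2 * s ^ 2 := by linarith
    calc (hammingNorm (view (h, k + 1, k) Z) : ℝ) =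
          s / (4 * e) * (4 * e / s * (hammingNorm (view (h, k + 1, k) Z) : ℝ)) := by field_simp
      _ ≤ s / (4 * e) * (2 * s ^ 2) := mul_le_mul_of_nonneg_left h1 (by positivity)
      _ = _ := by field_simp; norm_num
  have hpd := H.puncture_le (m := 1) (c := 2) (by norm_num) (by norm_num) (by norm_num)
  rw [pow_one] at hpd
  have hδs : 0 < δ * s ^ 2 := by positivity
  have hpw := H.norm_bound_le
  have hpos : 0 ≤ s ^ 2 / e + s ^ 3 / e / (δ * s ^ 2 - s ^ 2 / e) := by
    have h1 : 0 ≤ δ * s ^ 2 - s ^ 2 / e := by linarith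
    positivity
  have hfin := hD.norm_le_of_few_exceptional hrob hdA hdB hG.card_A hG.card_B (by positivity) hμ k h
    (by
      refine le_trans (le_of_eq ?_) hex
      rw [Decomposition.exceptionalDegree]
      push_cast
      rfl) (by rw [hΔs]; linarith) (by
      rw [hΔs]
      have h1 : 2 * s ^ 2 * (s / (8 * e)) = s ^ 3 / e / 4 := by field_simp; norm_num
      have h3 : 0 < s ^ 3 / e := by positivity
      linarith) (by
      rw [hΔs]
      have h1 : δ ^ 2 * s ^ 2 ≤ δ ^ 1 * s ^ 2 :=
        mul_le_mul_of_nonneg_right (H.pow_le_pow (by norm_num)) (sq_nonneg s)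
      rw [pow_one] at h1
      linarith)
  have hle : (D.regularDegree τ k h : ℝ) ≤ colNorm (view (h, k + 1, k) (D.C k)) +
      rowNorm (view (h, k + 1, k) (D.R (k + 1))) := by
    exact_mod_cast D.regularDegree_le τ k h
  rw [hΔs] at hfin
  linarith

end Counting

/-- The second inequality needs 1/2 - 2ε > 0, which is where ε < 1/4 enters. -/
theorem exists_threshold {ε K : ℝ} (hε : 0 < ε) (hε' : ε < 1 / 4) :
    ∃ Δ₀ : ℕ, ∀ Δ : ℕ, Δ₀ ≤ Δ → 1 ≤ Δ ∧ K ≤ (Δ : ℝ) ^ ε ∧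
      K * ((Δ : ℝ) ^ ε) ^ 2 ≤ Real.sqrt Δ := by
  have h1 : ∀ᶠ n : ℕ in Filter.atTop, K ≤ (n : ℝ) ^ ε :=
    ((tendsto_rpow_atTop hε).comp tendsto_natCast_atTop_atTop).eventually_ge_atTop K
  have h2 : ∀ᶠ n : ℕ in Filter.atTop, K ≤ (n : ℝ) ^ (1 / 2 - 2 * ε) :=
    ((tendsto_rpow_atTop (by linarith)).comp tendsto_natCast_atTop_atTop).eventually_ge_atTop K
  obtain ⟨N, hN⟩ := Filter.eventually_atTop.1
    (h1.and (h2.and (Filter.eventually_ge_atTop (1 : ℕ))))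
  refine ⟨N, fun Δ hΔ => ?_⟩
  obtain ⟨ha, hb, hc⟩ := hN Δ hΔ
  have hpos : (0 : ℝ) < Δ := by exact_mod_cast hc
  refine ⟨hc, ha, ?_⟩
  calc K * ((Δ : ℝ) ^ ε) ^ 2 ≤ (Δ : ℝ) ^ (1 / 2 - 2 * ε) * ((Δ : ℝ) ^ ε) ^ 2 := by gcongr
    _ = Real.sqrt Δ := by
      rw [Real.sqrt_eq_rpow, ← Real.rpow_natCast, ← Real.rpow_mul hpos.le, ← Real.rpow_add hpos]
      congr 1
      push_cast
      ring

end QTanner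

theorem mainTheorem5 :
    ∃ κ : ℝ, 0 < κ ∧
      ∀ ρ ε δ : ℝ, 0 < ρ → ρ < 1 / 2 → 0 < ε → ε < 1 / 4 → 0 < δ →
        ∃ Δ₀ : ℕ, ∀ Δ : ℕ, Δ₀ ≤ Δ →
          ∀ (G : Type u) [Group G] [Fintype G] (A B : Finset G),
            QTanner.GoodGenerators A B Δ →
            ∀ (CA : Submodule (ZMod 2) (A → ZMod 2)) (CB : Submodule (ZMod 2) (B → ZMod 2)),
              QTanner.GoodComponentCodes ρ ε δ Δ CA CB →
              ∀ (Z : QTanner.Square A B → ZMod 2) (D : QTanner.Decomposition CA CB),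
                QTanner.IsStalled CA CB Z →
                D.IsMinimal Z →
                (D.active.card : ℝ) ≤ δ / (8 * Δ) * ((QTanner.V0 G).card : ℝ) →
                κ * (D.active.card : ℝ) * (Δ : ℝ) ^ (1 / 2 - ε) ≤ (hammingNorm Z : ℝ) := by
  refine ⟨1 / 64, by norm_num, fun ρ ε δ _ _ hε hε' hδ => ?_⟩
  obtain ⟨Δ₀, hΔ₀⟩ := QTanner.exists_threshold (K := 2 ^ 22 / δ ^ 3) hε hε'
  refine ⟨Δ₀, fun Δ hΔ G _ _ A B hG CA CB hC Z D hZ hD hact => ?_⟩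
  obtain ⟨hΔ1, he, hs⟩ := hΔ₀ Δ hΔ
  have hpos : (0 : ℝ) < Δ := by exact_mod_cast hΔ1
  have hsqrt : Real.sqrt Δ = (Δ : ℝ) ^ (1 / 2 : ℝ) := Real.sqrt_eq_rpow _
  -- The positive minimum distance is attained by a word of length Δ, hence δ Δ ≤ Δ.
  have hδ1 : δ ≤ 1 := by
    have h1 : 0 < (QTanner.minDist CA : ℝ) := lt_of_lt_of_le (by positivity) hC.dist_A
    obtain ⟨x, -, -, hx⟩ := QTanner.exists_minDist (C := CA) (by
      intro h0
      simp [h0] at h1)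
    have h2 : hammingNorm x ≤ Fintype.card A := hammingNorm_le_card_fintype
    rw [Fintype.card_coe, hG.card_A, hx] at h2
    have h3 : (QTanner.minDist CA : ℝ) ≤ Δ := by exact_mod_cast h2
    have h4 := hC.dist_A.trans h3
    by_contra! h5
    nlinarith
  have hx : (Δ : ℝ) ^ (1 / 2 - ε) = Real.sqrt Δ / (Δ : ℝ) ^ ε := by
    rw [hsqrt, Real.rpow_sub hpos]
  have hw : (Δ : ℝ) ^ (3 / 2 - ε) = Real.sqrt Δ ^ 3 / (Δ : ℝ) ^ ε := by
    rw [Real.rpow_sub hpos, hsqrt, ← Real.rpow_natCast, ← Real.rpow_mul hpos.le]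
    norm_num
  have hp : (Δ : ℝ) ^ (1 - ε) = Real.sqrt Δ ^ 2 / (Δ : ℝ) ^ ε := by
    rw [Real.rpow_sub hpos, Real.rpow_one, Real.sq_sqrt hpos.le]
  have hrob := hC.robust_one
  rw [hw, hp] at hrob
  rw [hx]
  rw [div_le_iff₀ (by positivity)] at he
  rw [div_mul_eq_mul_div, div_le_iff₀ (by positivity)] at hs
  exact hD.card_le_of_stalled hG hZ
    ⟨hδ, hδ1, Real.sqrt_pos.2 hpos, Real.rpow_pos_of_pos hpos ε, by linarith, by linarith⟩
    (Real.sq_sqrt hpos.le).symm hrob hC.dist_A hC.dist_B hact
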